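/- Let $d\ge 1$, let $D\subset\mathbb R^d$ be a (nonempty, open) bounded convex domain, let $S\subset\mathbb R^d$ be the unit sphere with the normalized surface measure $ds$, and let $\mathbf n(x)$ denote the outward unit normal at those $x\in\partial D$ where it is well defined (almost all of $\partial D$). Put $\Gamma_\pm=\{(x,s)\in\partial D\times S:\ \pm\, s\cdot\mathbf n(x)>0\}$. Let $$H(D\times S)=\{v\in L_2(D\times S):\ s\cdot\nabla v\in L_2(D\times S)\},\qquad \|v\|_{H(D\times S)}^2=\|s\cdot\nabla v\|_{L_2(D\times S)}^2+\|v\|_{L_2(D\times S)}^2,$$ where $s\cdot\nabla$ acts in $x$ and is understood weakly, and let $H_{0,\pm}(D\times S)$ be the closure in $H(D\times S)$ of $\{v\in C^1(\overline{D\times S}):\ v|_{\Gamma_\pm}=0\}$. Let $\sigma:D\times S\to\mathbb R$ and $K:D\times S\times S\to\mathbb R$ be measurable with $$0\le\sigma\le\sigma_{\max}<\infty,\qquad K\ge 0,\qquad K\in L_\infty(D;L_2(S\times S)),$$ and suppose that, with $\bar\sigma(x,s)=\int_S K(x,s,s')\,ds'$ and $\bar\sigma'(x,s)=\int_S K(x,s',s)\,ds'$,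 there are constants $0<\alpha,M_a,M_a'<\infty$ such that for almost all $(x,s)\in D\times S$ $$\sigma-\bar\sigma\ge\alpha,\qquad \sigma-\bar\sigma'\ge\alpha,\qquad \bar\sigma\le M_a,\qquad \bar\sigma'\le M_a'.$$ Define $$\mathcal T w=s\cdot\nabla w+\sigma w,\qquad (\mathcal B w)(x,s)=(\mathcal T w)(x,s)-\int_S K(x,s',s)\,w(x,s')\,ds',$$ and the formal adjoints $$\mathcal T' w=-s\cdot\nabla w+\sigma w,\qquad (\mathcal B' w)(x,s)=(\mathcal T' w)(x,s)-\int_S K(x,s,s')\,w(x,s')\,ds'.$$ Then $\mathcal B w,\mathcal T w\in L_2(D\times S)$ for $w\in H_{0,-}(D\times S)$, $\mathcal B' w,\mathcal T' w\in L_2(D\times S)$ for $w\in H_{0,+}(D\times S)$, and $$\|w\|_{H(D\times S)}\sim\|\mathcal B w\|_{L_2(D\times S)}\sim\|\mathcal T w\|_{L_2(D\times S)},\qquad w\in H_{0,-}(D\times S),$$ $$\|w\|_{H(D\times S)}\sim\|\mathcal B' w\|_{L_2(D\times S)}\sim\|\mathcal T' w\|_{L_2(D\times S)},\qquad w\in H_{0,+}(D\times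 S).$$ Here $a\sim b$ means $a\le C\,b$ and $b\le C\,a$ with a constant $C$ that depends only on bounds for the optical parameters: on $\alpha,\sigma_{\max},M_a,M_a'$ (and possibly on $d$), but not on $w$, $D$ or otherwise on $\sigma,K$. -/

import Mathlib

open MeasureTheory Metric Set
open scoped ENNReal NNReal ContDiff

noncomputable section

namespace RadTrans

/-- The Euclidean space `ℝ^d`. -/
abbrev Space (d : ℕ) : Type := EuclideanSpace ℝ (Fin d)

/-- The unit sphere `S ⊆ ℝ^d` of transport directions. -/
abbrev Dir (d : ℕ) : Type := sphere (0 : Space d) 1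

/-- The normalized (probability) surface measure `ds` on the unit sphere. -/
def dirMeasure (d : ℕ) : Measure (Dir d) :=
  ((volume : Measure (Space d)).toSphere univ)⁻¹ • (volume : Measure (Space d)).toSphere

/-- The measure `dx ds` on the phase space `D × S`. -/
def phaseMeasure {d : ℕ} (D : Set (Space d)) : Measure (Space d × Dir d) :=
  (volume.restrict D).prod (dirMeasure d)

/-- The domains under consideration: nonempty bounded open convex subsets of `ℝ^d`. -/
structure IsBoundedConvexDomain {d : ℕ} (D : Set (Space d)) : Prop where
  isOpen : IsOpen D
  nonempty : D.Nonempty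
  isBounded : Bornology.IsBounded D
  convex : Convex ℝ D

/-- `n` is the outward unit normal of the convex domain `D` at the boundary point `x`: the normal
is well defined at `x` (there is only one supporting hyperplane), and `n` is it. -/
def IsOutwardNormal {d : ℕ} (D : Set (Space d)) (x n : Space d) : Prop :=
  x ∈ frontier D ∧ ∀ m : Space d, (‖m‖ = 1 ∧ ∀ y ∈ D, inner ℝ m (y - x) ≤ 0) ↔ m = n

/-- The inflow boundary `Γ₋ ⊆ ∂D × S`. -/
def inflow {d : ℕ} (D : Set (Space d)) : Set (Space d × Dir d) :=
  {p | ∃ n, IsOutwardNormal D p.1 n ∧ inner ℝ (p.2 : Space d) n < 0}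

/-- The outflow boundary `Γ₊ ⊆ ∂D × S`. -/
def outflow {d : ℕ} (D : Set (Space d)) : Set (Space d × Dir d) :=
  {p | ∃ n, IsOutwardNormal D p.1 n ∧ 0 < inner ℝ (p.2 : Space d) n}

/-- The restriction to `ℝ^d × S` of a function on `ℝ^d × ℝ^d`. -/
def onPhase {d : ℕ} (φ : Space d × Space d → ℝ) (p : Space d × Dir d) : ℝ :=
  φ (p.1, (p.2 : Space d))

/-- The classical transport derivative `(x, s) ↦ s · ∇ₓ φ(x, s)` of a differentiable function. -/
def classicalTransportDeriv {d : ℕ} (φ : Space d × Space d → ℝ) (p : Space d × Dir d) : ℝ :=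
  fderiv ℝ (fun y : Space d => φ (y, (p.2 : Space d))) p.1 (p.2 : Space d)

/-- `g` is the weak transport derivative `s · ∇ v` of `v` on `D × S`, tested with all (restrictions
to `D × S` of) smooth functions with compact support in `D × ℝ^d`. -/
def IsWeakTransportDeriv {d : ℕ} (D : Set (Space d)) (v g : Space d × Dir d → ℝ) : Prop :=
  ∀ φ : Space d × Space d → ℝ, ContDiff ℝ ∞ φ → HasCompactSupport φ → tsupport φ ⊆ D ×ˢ univ →
    ∫ p, v p * classicalTransportDeriv φ p ∂(phaseMeasure D)
      = -∫ p, g p * onPhase φ p ∂(phaseMeasure D)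

/-- Membership in `H(D × S) = {v ∈ L₂(D × S) | s · ∇ v ∈ L₂(D × S)}`. -/
def MemH {d : ℕ} (D : Set (Space d)) (v : Space d × Dir d → ℝ) : Prop :=
  MemLp v 2 (phaseMeasure D) ∧
    ∃ g, MemLp g 2 (phaseMeasure D) ∧ IsWeakTransportDeriv D v g

open Classical in
/-- The weak derivative `𝒜 v = s · ∇ v ∈ L₂(D × S)` of `v ∈ H(D × S)`. It is unique up to null sets,
see `IsWeakTransportDeriv.unique`; outside of `H(D × S)` the value is the default `0`. -/
def transportDeriv {d : ℕ} (D : Set (Space d)) (v : Space d × Dir d → ℝ) : Space d × Dir d → ℝ :=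
  if h : MemH D v then h.2.choose else 0

/-- The norm of `L₂(D × S)`. -/
def l2Norm {d : ℕ} (D : Set (Space d)) (v : Space d × Dir d → ℝ) : ℝ≥0∞ :=
  eLpNorm v 2 (phaseMeasure D)

/-- The norm of `H(D × S)`. -/
def hNorm {d : ℕ} (D : Set (Space d)) (v : Space d × Dir d → ℝ) : ℝ≥0∞ :=
  (l2Norm D (transportDeriv D v) ^ 2 + l2Norm D v ^ 2) ^ (1 / 2 : ℝ)

/-- Membership in the closure, in `H(D × S)`, of the `C¹`-functions on the closure of `D × S` that
vanish on `Γ`. The `C¹`-functions on the closure of `D × S` are the restrictions of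
`C¹`-functions on `ℝ^d × ℝ^d`. -/
def MemHZero {d : ℕ} (D : Set (Space d)) (Γ : Set (Space d × Dir d))
    (w : Space d × Dir d → ℝ) : Prop :=
  MemH D w ∧ ∀ ε : ℝ≥0∞, 0 < ε → ∃ φ : Space d × Space d → ℝ,
    ContDiff ℝ 1 φ ∧ (∀ p ∈ Γ, onPhase φ p = 0) ∧ hNorm D (fun p => w p - onPhase φ p) < ε

/-- Membership in `H_{0,-}(D × S)`. -/
def MemHZeroMinus {d : ℕ} (D : Set (Space d)) (w : Space d × Dir d → ℝ) : Prop :=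
  MemHZero D (inflow D) w

/-- Membership in `H_{0,+}(D × S)`. -/
def MemHZeroPlus {d : ℕ} (D : Set (Space d)) (w : Space d × Dir d → ℝ) : Prop :=
  MemHZero D (outflow D) w

/-- The collision operator, `(𝒦 w)(x, s) = ∫ K(x, s', s) w(x, s') ds'`. -/
def collision {d : ℕ} (K : Space d × Dir d × Dir d → ℝ) (w : Space d × Dir d → ℝ)
    (p : Space d × Dir d) : ℝ :=
  ∫ s', K (p.1, s', p.2) * w (p.1, s') ∂(dirMeasure d)

/-- The adjoint collision operator, `(𝒦' w)(x, s) = ∫ K(x, s, s') w(x, s') ds'`. -/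
def collisionAdj {d : ℕ} (K : Space d × Dir d × Dir d → ℝ) (w : Space d × Dir d → ℝ)
    (p : Space d × Dir d) : ℝ :=
  ∫ s', K (p.1, p.2, s') * w (p.1, s') ∂(dirMeasure d)

/-- The transport operator `𝒯 w = s · ∇ w + σ w`. -/
def transportOp {d : ℕ} (D : Set (Space d)) (σ w : Space d × Dir d → ℝ)
    (p : Space d × Dir d) : ℝ :=
  transportDeriv D w p + σ p * w p

/-- The formal adjoint `𝒯' w = -s · ∇ w + σ w`. -/
def transportOpAdj {d : ℕ} (D : Set (Space d)) (σ w : Space d × Dir d → ℝ)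
    (p : Space d × Dir d) : ℝ :=
  -transportDeriv D w p + σ p * w p

/-- The radiative transfer operator `ℬ = 𝒯 - 𝒦`. -/
def radOp {d : ℕ} (D : Set (Space d)) (σ : Space d × Dir d → ℝ)
    (K : Space d × Dir d × Dir d → ℝ) (w : Space d × Dir d → ℝ) (p : Space d × Dir d) : ℝ :=
  transportOp D σ w p - collision K w p

/-- The formal adjoint `ℬ' = 𝒯' - 𝒦'`. -/
def radOpAdj {d : ℕ} (D : Set (Space d)) (σ : Space d × Dir d → ℝ)
    (K : Space d × Dir d × Dir d → ℝ) (w : Space d × Dir d → ℝ) (p : Space d × Dir d) : ℝ :=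
  transportOpAdj D σ w p - collisionAdj K w p

/-- The kernel average `σ̄(x, s) = ∫ K(x, s, s') ds'`. -/
def kernelAvg {d : ℕ} (K : Space d × Dir d × Dir d → ℝ) (p : Space d × Dir d) : ℝ :=
  ∫ s', K (p.1, p.2, s') ∂(dirMeasure d)

/-- The kernel average `σ̄'(x, s) = ∫ K(x, s', s) ds'`. -/
def kernelAvg' {d : ℕ} (K : Space d × Dir d × Dir d → ℝ) (p : Space d × Dir d) : ℝ :=
  ∫ s', K (p.1, s', p.2) ∂(dirMeasure d)

/-- The cross section is nonnegative, measurable and essentially bounded, by `σmax`. -/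
structure CrossSectionAssumption {d : ℕ} (D : Set (Space d)) (σ : Space d × Dir d → ℝ)
    (σmax : ℝ) : Prop where
  measurable : AEStronglyMeasurable σ (phaseMeasure D)
  nonneg : ∀ᵐ p ∂(phaseMeasure D), 0 ≤ σ p
  bounded : ∀ᵐ p ∂(phaseMeasure D), σ p ≤ σmax

/-- The kernel assumption: `K ≥ 0` and `K ∈ L_∞(D; L₂(S × S))`. -/
structure KernelAssumption {d : ℕ} (D : Set (Space d)) (K : Space d × Dir d × Dir d → ℝ) :
    Prop where
  measurable : AEStronglyMeasurable K
    ((volume.restrict D).prod ((dirMeasure d).prod (dirMeasure d)))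
  nonneg : ∀ᵐ q ∂((volume.restrict D).prod ((dirMeasure d).prod (dirMeasure d))), 0 ≤ K q
  bounded : ∃ M : ℝ≥0, ∀ᵐ x ∂(volume.restrict D),
    eLpNorm (fun q : Dir d × Dir d => K (x, q)) 2 ((dirMeasure d).prod (dirMeasure d)) ≤ M

/-- Dominating absorption: `σ - σ̄ ≥ α`, `σ - σ̄' ≥ α`, `σ̄ ≤ M`, `σ̄' ≤ M'`. -/
structure DominationAssumption {d : ℕ} (D : Set (Space d)) (σ : Space d × Dir d → ℝ)
    (K : Space d × Dir d × Dir d → ℝ) (α M M' : ℝ) : Prop where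
  gap : ∀ᵐ p ∂(phaseMeasure D), α ≤ σ p - kernelAvg K p
  gap' : ∀ᵐ p ∂(phaseMeasure D), α ≤ σ p - kernelAvg' K p
  bound : ∀ᵐ p ∂(phaseMeasure D), kernelAvg K p ≤ M
  bound' : ∀ᵐ p ∂(phaseMeasure D), kernelAvg' K p ≤ M'

/-- `a ∼ b` with constant `C`. -/
def EquivWith (C : ℝ≥0) (a b : ℝ≥0∞) : Prop := a ≤ C * b ∧ b ≤ C * a

instance (d : ℕ) : IsFiniteMeasure (dirMeasure d) := by
  refine ⟨?_⟩
  simp only [dirMeasure, Measure.smul_apply, smul_eq_mul]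
  rcases eq_or_ne ((volume : Measure (Space d)).toSphere univ) 0 with h | h
  · rw [h]; simp
  · rw [ENNReal.inv_mul_cancel h (measure_ne_top _ _)]; simp

/-- The weak transport derivative is unique in `L₂(D × S)`. -/
theorem IsWeakTransportDeriv.unique {d : ℕ} {D : Set (Space d)} (hD : IsBoundedConvexDomain D)
    {v g g' : Space d × Dir d → ℝ} (hg : MemLp g 2 (phaseMeasure D))
    (hg' : MemLp g' 2 (phaseMeasure D)) (h : IsWeakTransportDeriv D v g)
    (h' : IsWeakTransportDeriv D v g') : g =ᵐ[phaseMeasure D] g' := by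
  have : IsFiniteMeasure (volume.restrict D) := ⟨by
    rw [Measure.restrict_apply_univ]; exact hD.isBounded.measure_lt_top⟩
  have : IsFiniteMeasure (phaseMeasure D) := by unfold phaseMeasure; infer_instance
  have hgi : Integrable g (phaseMeasure D) := hg.integrable (by norm_num)
  have hgi' : Integrable g' (phaseMeasure D) := hg'.integrable (by norm_num)
  set ι : Space d × Dir d → Space d × Space d := fun p => (p.1, (p.2 : Space d)) with hι
  have hemb : MeasurableEmbedding ι :=
    (MeasurableEmbedding.id).prodMap (MeasurableEmbedding.subtype_coe isClosed_sphere.measurableSet)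
  set F : Space d × Space d → ℝ := Function.extend ι (fun p => g p - g' p) 0 with hF
  have hFι : ∀ p, F (ι p) = g p - g' p := fun p => hemb.injective.extend_apply _ _ _
  have hFint : Integrable F ((phaseMeasure D).map ι) := by
    rw [hemb.integrable_map_iff]
    refine (hgi.sub hgi').congr (Filter.Eventually.of_forall fun p => ?_)
    simp [hFι]
  have key : ∀ᵐ x ∂((phaseMeasure D).map ι), x ∈ D ×ˢ (univ : Set (Space d)) → F x = 0 := by
    refine (hD.isOpen.prod isOpen_univ).ae_eq_zero_of_integral_contDiff_smul_eq_zero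
      (hFint.locallyIntegrable.locallyIntegrableOn _) ?_
    intro φ hφ hc hs
    rw [hemb.integral_map]
    obtain ⟨B, hB⟩ := hc.exists_bound_of_continuous hφ.continuous
    have hm : AEStronglyMeasurable (onPhase φ) (phaseMeasure D) :=
      (hφ.continuous.comp (by fun_prop : Continuous ι)).aestronglyMeasurable
    have e1 : Integrable (fun p => g p * onPhase φ p) (phaseMeasure D) :=
      hgi.mul_bdd hm (Filter.Eventually.of_forall fun p => hB _)
    have e2 : Integrable (fun p => g' p * onPhase φ p) (phaseMeasure D) :=
      hgi'.mul_bdd hm (Filter.Eventually.of_forall fun p => hB _)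
    have e3 : ∀ p, φ (ι p) • F (ι p) = g p * onPhase φ p - g' p * onPhase φ p := by
      intro p; rw [hFι, smul_eq_mul, onPhase]; ring
    simp only [e3]
    rw [integral_sub e1 e2]
    have a1 := h φ hφ hc hs
    have a2 := h' φ hφ hc hs
    linarith
  rw [hemb.ae_map_iff] at key
  have hmem : ∀ᵐ p ∂(phaseMeasure D), p.1 ∈ D :=
    (Measure.quasiMeasurePreserving_fst (μ := volume.restrict D) (ν := dirMeasure d)).ae
      (ae_restrict_mem hD.isOpen.measurableSet)
  filter_upwards [key, hmem] with p hp hpD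
  have := hp ⟨hpD, mem_univ _⟩
  rw [hFι] at this
  linarith

end RadTrans

end

open RadTrans

/-! Both operators have the form `G + S` applied to `w`, with `G = s·∇w` and `S = σ w - 𝒦 w` or `S =
σ w`. Three facts suffice: `⟪w, G⟫ ≥ 0`, coercivity `α‖w‖² ≤ ⟪w, S⟫`, and `‖S‖ ≤ 2|σmax|‖w‖`. Then
`α‖w‖² ≤ ⟪w, G + S⟫` controls `w`, and `G = (G + S) - S` controls the derivative
(`norm_equiv_of_coercive`).

Coercivity comes from `2ab ≤ a² + b²` under the kernel: `⟪w, 𝒦 w⟫` is at most the integral of `c w²`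
for any common majorant `c` of the two marginals, and the gap conditions allow `c = σ - α`
(`lintegral_quadratic_le`). Boundedness of `𝒦` is the Schur test (`lintegral_schur_sq_le`).

Accretivity avoids traces and the divergence theorem. For a `C¹`-function `φ` and a direction `u`,
twice the integral of `φ ∂ᵤφ` over `D` is the limit of difference quotients of `φ²`. After a
translation the two integrals cancel, up to nonnegative terms, except at those `x` in `D` with `x -
h u` outside `D`. There `φ = O(h)`, because `φ` vanishes where the ray backwards from `x` leaves
`D`; so the quotient is bounded below by `-O(h)`. The boundary condition only speaks of points with
a unique normal, so almost every ray has to leave `D` at such a point: the entry time is concave,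
hence differentiable almost everywhere, and its derivative determines the supporting hyperplane
(`support_of_differentiableAt_entryTime`). Continuity of the inner product carries the sign to the
closure.

The adjoint case is the same with `-s·∇` and exchanged kernel directions. -/

noncomputable section

namespace RadTrans

open Filter Topology
open scoped RealInnerProductSpace Pointwise

/-! ### Entry times of rays and normals at entry points -/

section EntryTime

variable {d : ℕ}

/-- A locally Lipschitz function on an open set is differentiable almost everywhere on it. -/
theorem ae_differentiableAt_of_locallyLipschitzOn {D : Set (Space d)} (hD : IsOpen D)
    {f : Space d → ℝ} (hf : LocallyLipschitzOn D f) :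
    ∀ᵐ x ∂(volume.restrict D), DifferentiableAt ℝ f x := by
  rw [ae_restrict_iff' hD.measurableSet, ae_iff]
  refine measure_null_of_locally_null _ fun x hx => ?_
  have hxD : x ∈ D := by
    by_contra h
    exact hx fun h' => absurd h' h
  obtain ⟨C, t, ht, hC⟩ := hf hxD
  rw [hD.nhdsWithin_eq hxD] at ht
  refine ⟨interior t ∩ {a | ¬(a ∈ D → DifferentiableAt ℝ f a)}, ?_, ?_⟩
  · rw [inter_comm]
    exact inter_mem_nhdsWithin _ (interior_mem_nhds.2 ht)
  · have h := ae_iff.1 (hC.ae_differentiableWithinAt_of_mem (μ := volume))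
    refine measure_mono_null (fun y hy => ?_) h
    intro h'
    refine hy.2 fun _ => (h' (interior_subset hy.1)).differentiableAt ?_
    exact mem_interior_iff_mem_nhds.1 hy.1

/-- The time needed to reach the boundary of `D` when travelling from `x` in direction `-u`. -/
def entryTime (D : Set (Space d)) (u x : Space d) : ℝ := sSup {t : ℝ | x - t • u ∈ D}

variable {D : Set (Space d)} {u x : Space d}

theorem bddAbove_times (hD : IsBoundedConvexDomain D) (hu : ‖u‖ = 1) (x : Space d) :
    BddAbove {t : ℝ | x - t • u ∈ D} := by
  obtain ⟨R, hR⟩ := hD.isBounded.exists_norm_le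
  refine ⟨R + ‖x‖, fun t ht => ?_⟩
  have h1 := hR _ ht
  have h2 : ‖t • u‖ ≤ ‖x‖ + ‖x - t • u‖ := by
    simpa using norm_sub_le x (x - t • u)
  rw [norm_smul, hu, mul_one] at h2
  linarith [le_abs_self t, Real.norm_eq_abs t]

theorem entryTime_pos (hD : IsBoundedConvexDomain D) (hu : ‖u‖ = 1) {x : Space d} {t : ℝ}
    (hx : x - t • u ∈ D) : t < entryTime D u x := by
  have ho : IsOpen {t : ℝ | x - t • u ∈ D} := hD.isOpen.preimage (by fun_prop)
  obtain ⟨ε, hε, hb⟩ := Metric.isOpen_iff.1 ho t hx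
  have : t + ε / 2 ∈ {t : ℝ | x - t • u ∈ D} := hb (by
    rw [Metric.mem_ball, Real.dist_eq, add_sub_cancel_left, abs_of_pos (by positivity)]; linarith)
  have := le_csSup (bddAbove_times hD hu x) this
  change _ ≤ entryTime D u x at this
  linarith

theorem entryPoint_mem_closure (hD : IsBoundedConvexDomain D) (hu : ‖u‖ = 1) (hx : x ∈ D) :
    x - entryTime D u x • u ∈ closure D := by
  have h1 : entryTime D u x ∈ closure {t : ℝ | x - t • u ∈ D} :=
    csSup_mem_closure ⟨0, by simpa using hx⟩ (bddAbove_times hD hu x)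
  exact map_mem_closure (f := fun t : ℝ => x - t • u) (by fun_prop) h1 fun t ht => ht

theorem entryPoint_notMem (hD : IsBoundedConvexDomain D) (hu : ‖u‖ = 1) (x : Space d) :
    x - entryTime D u x • u ∉ D := fun h => lt_irrefl _ (entryTime_pos hD hu h)

/-- By convexity a ray that has left `D` never returns: a later time `t` inside `D` would put the
intermediate point at time `h` on a segment in `D`. -/
theorem entryTime_le_of_notMem (hD : IsBoundedConvexDomain D) (hx : x ∈ D) {h : ℝ} (hh : 0 ≤ h)
    (hxh : x - h • u ∉ D) : entryTime D u x ≤ h := by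
  refine csSup_le ⟨0, by simpa using hx⟩ fun t ht => ?_
  by_contra hlt
  push Not at hlt
  have ht0 : 0 < t := hh.trans_lt hlt
  apply hxh
  have := hD.convex hx ht (a := 1 - h / t) (b := h / t)
    (sub_nonneg.2 ((div_le_one ht0).2 hlt.le)) (by positivity) (by ring)
  convert this using 1
  rw [smul_sub, smul_smul, div_mul_cancel₀ _ ht0.ne', sub_smul, one_smul]
  abel

/-- Convex combinations of admissible times for `x` and `y` are admissible for the combined point;
take suprema. Concavity on an open set gives local Lipschitz continuity, hence differentiability
almost everywhere. -/
theorem concaveOn_entryTime (hD : IsBoundedConvexDomain D) (hu : ‖u‖ = 1) :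
    ConcaveOn ℝ D (entryTime D u) := by
  refine ⟨hD.convex, fun x hx y hy a b ha hb hab => ?_⟩
  have hbd := fun z => bddAbove_times hD hu z
  simp only [entryTime]
  rw [← Real.sSup_smul_of_nonneg ha, ← Real.sSup_smul_of_nonneg hb, ← csSup_add]
  · refine csSup_le_csSup (hbd _) ?_ ?_
    · exact Set.Nonempty.add (Set.Nonempty.smul_set ⟨0, by simpa using hx⟩)
        (Set.Nonempty.smul_set ⟨0, by simpa using hy⟩)
    · rintro _ ⟨_, ⟨t, ht, rfl⟩, _, ⟨r, hr, rfl⟩, rfl⟩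
      have := hD.convex ht hr ha hb hab
      simp only [mem_ofPred_eq, smul_eq_mul] at *
      convert this using 1
      module
  · exact Set.Nonempty.smul_set ⟨0, by simpa using hx⟩
  · exact (hbd x).smul_of_nonneg ha
  · exact Set.Nonempty.smul_set ⟨0, by simpa using hy⟩
  · exact (hbd y).smul_of_nonneg hb

/-- A convex domain has a supporting hyperplane at every point outside of it. -/
theorem exists_unit_support (hD : IsBoundedConvexDomain D) {y : Space d} (hy : y ∉ D) :
    ∃ m : Space d, ‖m‖ = 1 ∧ ∀ z ∈ D, ⟪m, z - y⟫ ≤ 0 := by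
  obtain ⟨f, hf⟩ := geometric_hahn_banach_open_point hD.convex hD.isOpen hy
  set n := (InnerProductSpace.toDual ℝ (Space d)).symm f with hn
  have hfn : ∀ z, f z = ⟪n, z⟫ := fun z => by simp [hn]
  obtain ⟨z₀, hz₀⟩ := hD.nonempty
  have hn0 : n ≠ 0 := by
    intro h
    have := hf z₀ hz₀
    simp [hfn, h] at this
  refine ⟨‖n‖⁻¹ • n, by rw [norm_smul, norm_inv, norm_norm, inv_mul_cancel₀ (norm_ne_zero_iff.2 hn0)],
    fun z hz => ?_⟩
  rw [real_inner_smul_left, inner_sub_right, ← hfn, ← hfn]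
  exact mul_nonpos_of_nonneg_of_nonpos (by positivity) (by linarith [hf z hz])

/-- At an entry point, a unit support vector is determined by the derivative of the entry time. -/
theorem support_of_differentiableAt_entryTime (hD : IsBoundedConvexDomain D) (hu : ‖u‖ = 1)
    (hx : x ∈ D) (hdiff : DifferentiableAt ℝ (entryTime D u) x) {m : Space d} (hm : ‖m‖ = 1)
    (hsup : ∀ z ∈ D, ⟪m, z - (x - entryTime D u x • u)⟫ ≤ 0) :
    ⟪m, u⟫ < 0 ∧ ∀ v, ⟪m, v⟫ = fderiv ℝ (entryTime D u) x v * ⟪m, u⟫ := by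
  have hcl : ∀ z ∈ closure D, ⟪m, z - (x - entryTime D u x • u)⟫ ≤ 0 := fun z hz =>
    closure_minimal (s := D) (t := {z | ⟪m, z - (x - entryTime D u x • u)⟫ ≤ 0}) hsup
      (isClosed_le (by fun_prop) continuous_const) hz
  -- This function is `⟪m, ·⟫` evaluated at the entry point of `z`, which stays in the closure of
  -- `D`; the supporting property makes it maximal at `z = x`.
  have hmax : IsLocalMax (fun z => ⟪m, z⟫ - entryTime D u z * ⟪m, u⟫) x := by
    filter_upwards [hD.isOpen.mem_nhds hx] with z hz
    have := hcl _ (entryPoint_mem_closure hD hu hz)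
    simp only [inner_sub_right, inner_smul_right] at this
    linarith
  have hder : HasFDerivAt (fun z => ⟪m, z⟫ - entryTime D u z * ⟪m, u⟫)
      (innerSL ℝ m - ⟪m, u⟫ • fderiv ℝ (entryTime D u) x) x :=
    (innerSL ℝ m).hasFDerivAt.sub (hdiff.hasFDerivAt.mul_const _)
  have h0 := hmax.hasFDerivAt_eq_zero hder
  have hv : ∀ v, ⟪m, v⟫ = fderiv ℝ (entryTime D u) x v * ⟪m, u⟫ := fun v => by
    have := DFunLike.congr_fun h0 v
    simp at this
    linarith
  refine ⟨lt_of_le_of_ne ?_ ?_, hv⟩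
  · have h1 := hsup x hx
    have h2 : 0 < entryTime D u x := entryTime_pos hD hu (by simpa using hx)
    rw [sub_sub_cancel, inner_smul_right] at h1
    by_contra hc
    push Not at hc
    nlinarith
  -- If `⟪m, u⟫ = 0`, the derivative formula at `v = m` forces `‖m‖² = 0`.
  · intro h
    have := hv m
    rw [h, mul_zero, real_inner_self_eq_norm_sq, hm] at this
    norm_num at this

/-- For almost every point of a convex domain, the outward unit normal is well defined at the point
where the ray in direction `-u` leaves the domain. -/
theorem ae_exists_outwardNormal_entryPoint (hD : IsBoundedConvexDomain D) (hu : ‖u‖ = 1) :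
    ∀ᵐ x ∂(volume.restrict D),
      ∃ n, IsOutwardNormal D (x - entryTime D u x • u) n ∧ ⟪u, n⟫ < 0 := by
  filter_upwards [ae_differentiableAt_of_locallyLipschitzOn hD.isOpen
    ((concaveOn_entryTime hD hu).locallyLipschitzOn hD.isOpen),
    ae_restrict_mem hD.isOpen.measurableSet] with x hdiff hx
  obtain ⟨n, hn, hns⟩ := exists_unit_support hD (entryPoint_notMem hD hu x)
  obtain ⟨hneg, hval⟩ := support_of_differentiableAt_entryTime hD hu hx hdiff hn hns
  refine ⟨n, ⟨?_, fun m => ⟨?_, ?_⟩⟩, by rwa [real_inner_comm]⟩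
  · rw [hD.isOpen.frontier_eq]
    exact ⟨entryPoint_mem_closure hD hu hx, entryPoint_notMem hD hu x⟩
  · rintro ⟨hm, hms⟩
    obtain ⟨hneg', hval'⟩ := support_of_differentiableAt_entryTime hD hu hx hdiff hm hms
    -- Both vectors represent the same derivative up to a scalar, so they are parallel; unit length
    -- and the common sign of the scalars then make them equal.
    have he : ⟪m, u⟫ • n = ⟪n, u⟫ • m := by
      refine ext_inner_right ℝ fun v => ?_
      rw [real_inner_smul_left, real_inner_smul_left, hval v, hval' v]
      ring
    have hc : ⟪m, u⟫ = ⟪n, u⟫ := by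
      have := congrArg norm he
      rw [norm_smul, norm_smul, hm, hn, mul_one, mul_one, Real.norm_of_nonpos hneg.le,
        Real.norm_of_nonpos hneg'.le] at this
      linarith
    rw [hc] at he
    exact (smul_right_injective _ hneg.ne he).symm
  · rintro rfl
    exact ⟨hn, hns⟩

end EntryTime

/-! ### Sign of the flux of `φ²` in a fixed direction -/

section Flux

variable {d : ℕ} {D : Set (Space d)} {u : Space d}

/-- A `C¹`-function is Lipschitz on every ball. -/
theorem exists_lipschitz_bound_closedBall {f : Space d → ℝ} (hf : ContDiff ℝ 1 f) (R : ℝ) :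
    ∃ L : ℝ, 0 ≤ L ∧ ∀ x ∈ closedBall (0 : Space d) R, ∀ y ∈ closedBall (0 : Space d) R,
      |f y - f x| ≤ L * ‖y - x‖ := by
  obtain ⟨L, hL⟩ := (isCompact_closedBall (0 : Space d) R).exists_bound_of_continuousOn
    (hf.continuous_fderiv one_ne_zero).continuousOn
  refine ⟨max L 0, le_max_right _ _, fun x hx y hy => ?_⟩
  exact (convex_closedBall (0 : Space d) R).norm_image_sub_le_of_norm_fderiv_le
    (fun z _ => hf.differentiable one_ne_zero z)
    (fun z hz => (hL z hz).trans (le_max_left _ _)) hx hy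

theorem integrableOn_of_continuous (hD : IsBoundedConvexDomain D) {f : Space d → ℝ}
    (hf : Continuous f) : IntegrableOn f D :=
  (hf.continuousOn.integrableOn_compact hD.isBounded.isCompact_closure).mono_set subset_closure

/-- A function which vanishes where the direction `u` enters the domain is small near the
entry points. -/
theorem ae_abs_le_of_entry {φ : Space d → ℝ} (hD : IsBoundedConvexDomain D) (hu : ‖u‖ = 1)
    (hφ : ContDiff ℝ 1 φ)
    (h0 : ∀ y n, IsOutwardNormal D y n → ⟪u, n⟫ < 0 → φ y = 0) :
    ∃ L : ℝ, 0 ≤ L ∧ ∀ᵐ x ∂volume, x ∈ D → ∀ h : ℝ, 0 ≤ h → x - h • u ∉ D → |φ x| ≤ L * h := by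
  obtain ⟨R, hR⟩ := hD.isBounded.subset_closedBall (0 : Space d)
  obtain ⟨L, hL0, hL⟩ := exists_lipschitz_bound_closedBall hφ R
  refine ⟨L, hL0, ?_⟩
  filter_upwards [(ae_restrict_iff' hD.isOpen.measurableSet).1
    (ae_exists_outwardNormal_entryPoint hD hu)] with x hx hxD h hh hxh
  obtain ⟨n, hn, hneg⟩ := hx hxD
  have hy := h0 _ n hn hneg
  have hc : x - entryTime D u x • u ∈ closedBall (0 : Space d) R :=
    closure_minimal hR isClosed_closedBall (entryPoint_mem_closure hD hu hxD)
  -- Compare `x` with its entry point, where `φ` vanishes; their distance is the entry time, which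
  -- is at most `h`.
  have h1 := hL _ hc x (hR hxD)
  have hpos : 0 < entryTime D u x := entryTime_pos hD hu (by simpa using hxD)
  rw [hy, sub_zero, sub_sub_cancel, norm_smul, hu, mul_one, Real.norm_of_nonneg hpos.le] at h1
  exact h1.trans (mul_le_mul_of_nonneg_left (entryTime_le_of_notMem hD hxD hh hxh) hL0)

/-- The difference quotients of a nonnegative function in direction `u` have an almost nonnegative
integral if the function is small where the shifted domain does not cover the domain. -/
theorem neg_le_setIntegral_shift_sub {f : Space d → ℝ} (hD : IsBoundedConvexDomain D)
    (hf : Continuous f) (hf0 : ∀ x, 0 ≤ f x) {h c : ℝ} (hc : 0 ≤ c)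
    (hsmall : ∀ᵐ x ∂volume, x ∈ D → x - h • u ∉ D → f x ≤ c) :
    -(c * volume.real D) ≤ ∫ x in D, (f (x + h • u) - f x) := by
  have hm := hD.isOpen.measurableSet
  have hi1 : IntegrableOn (fun x => f (x + h • u)) D := integrableOn_of_continuous hD (by fun_prop)
  have hi2 : IntegrableOn f D := integrableOn_of_continuous hD hf
  have hi1' : Integrable (fun x => D.indicator (fun x => f (x + h • u)) (x - h • u)) volume :=
    ((integrable_indicator_iff hm).2 hi1).comp_sub_right _
  have hi2' : Integrable (D.indicator f) volume := (integrable_indicator_iff hm).2 hi2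
  have hfin : volume D ≠ ⊤ := hD.isBounded.measure_lt_top.ne
  have hi3 : Integrable (D.indicator fun _ => c) volume :=
    (integrable_indicator_iff hm).2 (integrableOn_const hfin)
  rw [integral_sub hi1 hi2, ← integral_indicator hm, ← integral_indicator hm,
    ← integral_sub_right_eq_self (D.indicator fun x => f (x + h • u)) (h • u),
    ← integral_sub hi1' hi2']
  have : c * volume.real D = ∫ x, D.indicator (fun _ => c) x := by
    rw [integral_indicator hm, setIntegral_const, smul_eq_mul, mul_comm]
  rw [this, ← integral_neg]
  refine integral_mono_ae hi3.neg (hi1'.sub hi2') ?_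
  -- After the translation the integrand is `f x` times the indicator of `x - h • u ∈ D` minus that
  -- of `x ∈ D`: it is `0` where both hold, at least `-c` where only `x ∈ D`, and nonnegative
  -- elsewhere.
  filter_upwards [hsmall] with x hx
  by_cases h1 : x ∈ D <;> by_cases h2 : x - h • u ∈ D <;> simp [h1, h2]
  · exact hc
  · exact hx h1 h2
  · exact hf0 x

/-- The flux of `φ²` in direction `u` is nonnegative if `φ` vanishes at the inflow boundary. -/
theorem setIntegral_mul_fderiv_nonneg {φ : Space d → ℝ} (hD : IsBoundedConvexDomain D)
    (hu : ‖u‖ = 1) (hφ : ContDiff ℝ 1 φ)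
    (h0 : ∀ y n, IsOutwardNormal D y n → ⟪u, n⟫ < 0 → φ y = 0) :
    0 ≤ ∫ x in D, φ x * fderiv ℝ φ x u := by
  set f : Space d → ℝ := fun x => φ x * φ x with hfdef
  have hf : ContDiff ℝ 1 f := hφ.mul hφ
  have hfd : ∀ x, fderiv ℝ f x u = 2 * (φ x * fderiv ℝ φ x u) := fun x => by
    have hx := hφ.differentiable one_ne_zero x
    rw [hfdef, fderiv_fun_mul hx hx]
    simp
    ring
  obtain ⟨R, hR⟩ := hD.isBounded.subset_closedBall (0 : Space d)
  -- The steps satisfy `h n ≤ 1`, so radius `R + 1` also contains the shifted points.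
  obtain ⟨L, hL0, hL⟩ := exists_lipschitz_bound_closedBall hf (R + 1)
  obtain ⟨N, hN0, hN⟩ := ae_abs_le_of_entry hD hu hφ h0
  set h : ℕ → ℝ := fun n => 1 / ((n : ℝ) + 1) with hh
  have hpos : ∀ n, 0 < h n := fun n => Nat.one_div_pos_of_nat
  have hlim : Tendsto h atTop (𝓝 0) := tendsto_one_div_add_atTop_nhds_zero_nat
  have hfin : volume D ≠ ⊤ := hD.isBounded.measure_lt_top.ne
  have hT : Tendsto (fun n => ∫ x in D, (h n)⁻¹ * (f (x + h n • u) - f x)) atTop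
      (𝓝 (∫ x in D, fderiv ℝ f x u)) := by
    refine tendsto_integral_of_dominated_convergence (fun _ => L) (fun n => ?_)
      (integrableOn_const hfin) (fun n => ?_) ?_
    · have := hf.continuous
      exact (by fun_prop : Continuous fun x => (h n)⁻¹ * (f (x + h n • u) - f x)).aestronglyMeasurable
    · filter_upwards [ae_restrict_mem hD.isOpen.measurableSet] with x hx
      have hxR : ‖x‖ ≤ R := by simpa using hR hx
      have hn : ‖h n • u‖ = h n := by rw [norm_smul, hu, mul_one, Real.norm_of_nonneg (hpos n).le]
      have hn1 : h n ≤ 1 := by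
        rw [hh]
        exact (div_le_one (by positivity)).2 (by linarith [(Nat.cast_nonneg n : (0 : ℝ) ≤ n)])
      have := hL x (by simpa using by linarith) (x + h n • u) (by
        rw [mem_closedBall_zero_iff]
        linarith [norm_add_le x (h n • u)])
      rw [add_sub_cancel_left, hn] at this
      rw [norm_mul, norm_inv, Real.norm_of_nonneg (hpos n).le, Real.norm_eq_abs,
        inv_mul_le_iff₀ (hpos n)]
      linarith
    · refine Eventually.of_forall fun x => ?_
      have hd := (hf.differentiable one_ne_zero x).hasFDerivAt.hasLineDerivAt u
      have := hd.tendsto_slope_zero.comp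
        (tendsto_nhdsWithin_iff.2 ⟨hlim, Eventually.of_forall fun n => (hpos n).ne'⟩)
      simpa [Function.comp_def] using this
  -- The boundary layer contributes at most `(N h)²` per unit volume; division by `h` leaves a
  -- quantity of order `h`.
  have hB : Tendsto (fun n => -(N ^ 2 * volume.real D * h n)) atTop (𝓝 0) := by
    simpa using (hlim.const_mul (N ^ 2 * volume.real D)).neg
  have hle := le_of_tendsto_of_tendsto' hB hT fun n => by
    rw [integral_const_mul]
    have := neg_le_setIntegral_shift_sub (u := u) (h := h n) (c := (N * h n) ^ 2) hD hf.continuous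
      (fun x => mul_self_nonneg (φ x)) (by positivity) (by
        filter_upwards [hN] with x hx hxD hxh
        have := hx hxD (h n) (hpos n).le hxh
        rw [hfdef]
        simp only
        rw [← sq, ← sq_abs]
        gcongr)
    rw [le_inv_mul_iff₀ (hpos n)]
    calc _ = -((N * h n) ^ 2 * volume.real D) := by ring
      _ ≤ _ := this
  simp only [hfd, integral_const_mul] at hle
  linarith

end Flux

/-! ### Weak derivatives, and passage from `C¹`-functions to the closure -/

section Smooth

variable {d : ℕ} {D : Set (Space d)}

theorem IsBoundedConvexDomain.isFiniteMeasure_restrict (hD : IsBoundedConvexDomain D) :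
    IsFiniteMeasure ((volume : Measure (Space d)).restrict D) :=
  ⟨by rw [Measure.restrict_apply_univ]; exact hD.isBounded.measure_lt_top⟩

theorem IsBoundedConvexDomain.isFiniteMeasure_phaseMeasure (hD : IsBoundedConvexDomain D) :
    IsFiniteMeasure (phaseMeasure D) := by
  have := hD.isFiniteMeasure_restrict
  unfold phaseMeasure
  infer_instance

theorem ae_phaseMeasure_fst_mem (hD : IsBoundedConvexDomain D) :
    ∀ᵐ p ∂(phaseMeasure D), p.1 ∈ D :=
  (Measure.quasiMeasurePreserving_fst (μ := volume.restrict D) (ν := dirMeasure d)).ae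
    (ae_restrict_mem hD.isOpen.measurableSet)

theorem memLp_of_continuous (hD : IsBoundedConvexDomain D) {f : Space d × Dir d → ℝ}
    (hf : Continuous f) : MemLp f 2 (phaseMeasure D) := by
  have := hD.isFiniteMeasure_phaseMeasure
  obtain ⟨C, hC⟩ := (hD.isBounded.isCompact_closure.prod
    (isCompact_univ : IsCompact (univ : Set (Dir d)))).exists_bound_of_continuousOn hf.continuousOn
  refine MemLp.of_bound hf.aestronglyMeasurable C ?_
  filter_upwards [ae_phaseMeasure_fst_mem hD] with p hp
  exact hC p ⟨subset_closure hp, mem_univ _⟩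

theorem continuous_onPhase {φ : Space d × Space d → ℝ} (hφ : Continuous φ) :
    Continuous (onPhase φ) := by
  unfold onPhase
  fun_prop

theorem classicalTransportDeriv_eq {φ : Space d × Space d → ℝ} (hφ : ContDiff ℝ 1 φ)
    (p : Space d × Dir d) :
    classicalTransportDeriv φ p = fderiv ℝ φ (p.1, (p.2 : Space d)) ((p.2 : Space d), 0) := by
  have h1 : HasFDerivAt (fun y : Space d => (y, (p.2 : Space d)))
      (ContinuousLinearMap.inl ℝ (Space d) (Space d)) p.1 := hasFDerivAt_prodMk_left _ _
  have h2 := (hφ.differentiable one_ne_zero (p.1, (p.2 : Space d))).hasFDerivAt.comp p.1 h1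
  unfold classicalTransportDeriv
  rw [show (fun y : Space d => φ (y, (p.2 : Space d))) =
    φ ∘ fun y : Space d => (y, (p.2 : Space d)) from rfl, h2.fderiv]
  simp

theorem continuous_classicalTransportDeriv {φ : Space d × Space d → ℝ} (hφ : ContDiff ℝ 1 φ) :
    Continuous (classicalTransportDeriv φ) := by
  rw [funext (classicalTransportDeriv_eq hφ)]
  have := hφ.continuous_fderiv one_ne_zero
  exact (this.comp (by fun_prop : Continuous fun p : Space d × Dir d =>
    (p.1, (p.2 : Space d)))).clm_apply (by fun_prop)

/-- Integration by parts against a test function supported in the open set `D`. -/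
theorem setIntegral_mul_fderiv_eq_neg {f g : Space d → ℝ} {u : Space d}
    (hf : ContDiff ℝ 1 f) (hg : ContDiff ℝ 1 g) (hc : HasCompactSupport g) (hs : tsupport g ⊆ D) :
    ∫ x in D, f x * fderiv ℝ g x u = -∫ x in D, fderiv ℝ f x u * g x := by
  have hfd : Continuous fun x => fderiv ℝ f x u :=
    (hf.continuous_fderiv one_ne_zero).clm_apply continuous_const
  have hgd : Continuous fun x => fderiv ℝ g x u :=
    (hg.continuous_fderiv one_ne_zero).clm_apply continuous_const
  have hcd : HasCompactSupport fun x => fderiv ℝ g x u := hc.fderiv_apply ℝ u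
  rw [setIntegral_eq_integral_of_forall_compl_eq_zero, setIntegral_eq_integral_of_forall_compl_eq_zero]
  · exact integral_mul_fderiv_eq_neg_fderiv_mul_of_integrable
      ((hfd.mul hg.continuous).integrable_of_hasCompactSupport hc.mul_left)
      ((hf.continuous.mul hgd).integrable_of_hasCompactSupport hcd.mul_left)
      ((hf.continuous.mul hg.continuous).integrable_of_hasCompactSupport hc.mul_left)
      (fun x _ => hf.differentiable one_ne_zero x) (fun x _ => hg.differentiable one_ne_zero x)
  · intro x hx
    rw [image_eq_zero_of_notMem_tsupport fun h => hx (hs h), mul_zero]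
  · intro x hx
    have : fderiv ℝ g x = 0 :=
      image_eq_zero_of_notMem_tsupport fun h => hx (hs (tsupport_fderiv_subset ℝ h))
    rw [this]
    simp

/-- The integral over phase space, computed direction by direction. -/
theorem integral_phaseMeasure_eq (hD : IsBoundedConvexDomain D) {f : Space d × Dir d → ℝ}
    (hf : Continuous f) :
    ∫ p, f p ∂(phaseMeasure D) = ∫ s, (∫ x in D, f (x, s)) ∂(dirMeasure d) := by
  have := hD.isFiniteMeasure_restrict
  have := hD.isFiniteMeasure_phaseMeasure
  exact integral_prod_symm f ((memLp_of_continuous hD hf).integrable (by norm_num))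

/-- The classical transport derivative of a `C¹`-function is its weak transport derivative. -/
theorem isWeakTransportDeriv_classical (hD : IsBoundedConvexDomain D)
    {φ : Space d × Space d → ℝ} (hφ : ContDiff ℝ 1 φ) :
    IsWeakTransportDeriv D (onPhase φ) (classicalTransportDeriv φ) := by
  intro ψ hψ hc hs
  have hψ1 : ContDiff ℝ 1 ψ := hψ.of_le (by exact_mod_cast le_top)
  rw [integral_phaseMeasure_eq hD ((continuous_onPhase hφ.continuous).fun_mul
      (continuous_classicalTransportDeriv hψ1)),
    integral_phaseMeasure_eq hD ((continuous_classicalTransportDeriv hφ).fun_mul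
      (continuous_onPhase hψ.continuous)), ← integral_neg]
  congr 1 with s
  have hemb : IsClosedEmbedding fun y : Space d => (y, (s : Space d)) :=
    Topology.IsClosedEmbedding.of_continuous_injective_isClosedMap (by fun_prop)
      (fun _ _ h => (Prod.mk.inj h).1) (isClosedMap_prodMk_right _)
  refine setIntegral_mul_fderiv_eq_neg (f := fun y => φ (y, (s : Space d)))
    (g := fun y => ψ (y, (s : Space d))) (D := D) (u := s) (hφ.comp (by fun_prop)) (hψ1.comp (by fun_prop))
    (hc.comp_isClosedEmbedding hemb) ?_
  intro x hx
  exact (hs (tsupport_comp_subset_preimage ψ hemb.continuous hx)).1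

theorem IsWeakTransportDeriv.sub (hD : IsBoundedConvexDomain D)
    {v v' g g' : Space d × Dir d → ℝ}
    (hv : MemLp v 2 (phaseMeasure D)) (hv' : MemLp v' 2 (phaseMeasure D))
    (hg : MemLp g 2 (phaseMeasure D)) (hg' : MemLp g' 2 (phaseMeasure D))
    (h : IsWeakTransportDeriv D v g) (h' : IsWeakTransportDeriv D v' g') :
    IsWeakTransportDeriv D (fun p => v p - v' p) (fun p => g p - g' p) := by
  intro ψ hψ hc hs
  have hψ1 : ContDiff ℝ 1 ψ := hψ.of_le (by exact_mod_cast le_top)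
  have h1 := memLp_of_continuous hD (continuous_classicalTransportDeriv hψ1)
  have h2 := memLp_of_continuous hD (continuous_onPhase hψ.continuous)
  simp only [sub_mul]
  have e1 := integral_sub (hv.integrable_mul h1) (hv'.integrable_mul h1)
  have e2 := integral_sub (hg.integrable_mul h2) (hg'.integrable_mul h2)
  simp only [Pi.mul_apply] at e1 e2
  rw [e1, e2, h ψ hψ hc hs, h' ψ hψ hc hs]
  ring

theorem MemH.memLp_transportDeriv {v : Space d × Dir d → ℝ} (h : MemH D v) :
    MemLp (transportDeriv D v) 2 (phaseMeasure D) := by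
  unfold transportDeriv
  rw [dif_pos h]
  exact h.2.choose_spec.1

theorem MemH.isWeakTransportDeriv {v : Space d × Dir d → ℝ} (h : MemH D v) :
    IsWeakTransportDeriv D v (transportDeriv D v) := by
  unfold transportDeriv
  rw [dif_pos h]
  exact h.2.choose_spec.2

/-- `transportDeriv` is a choice, so its additivity is only available almost everywhere, through
uniqueness of the weak derivative. -/
theorem transportDeriv_sub_onPhase (hD : IsBoundedConvexDomain D) {w : Space d × Dir d → ℝ}
    (hw : MemH D w) {φ : Space d × Space d → ℝ} (hφ : ContDiff ℝ 1 φ) :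
    transportDeriv D (fun p => w p - onPhase φ p) =ᵐ[phaseMeasure D]
      fun p => transportDeriv D w p - classicalTransportDeriv φ p := by
  have h1 := memLp_of_continuous hD (continuous_onPhase hφ.continuous)
  have h2 := memLp_of_continuous hD (continuous_classicalTransportDeriv hφ)
  have h3 := IsWeakTransportDeriv.sub hD hw.1 h1 hw.memLp_transportDeriv h2
    hw.isWeakTransportDeriv (isWeakTransportDeriv_classical hD hφ)
  -- Membership ensures that `transportDeriv` of the difference is a genuine weak derivative and not
  -- the default `0`.
  have h4 : MemH D fun p => w p - onPhase φ p := ⟨hw.1.sub h1, _, hw.memLp_transportDeriv.sub h2, h3⟩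
  exact IsWeakTransportDeriv.unique hD h4.memLp_transportDeriv (hw.memLp_transportDeriv.sub h2)
    h4.isWeakTransportDeriv h3

/-- The flux of a `C¹`-function which vanishes at the inflow boundary is nonnegative. -/
theorem integral_classical_nonneg (hD : IsBoundedConvexDomain D) {φ : Space d × Space d → ℝ}
    (hφ : ContDiff ℝ 1 φ) (h0 : ∀ p ∈ inflow D, onPhase φ p = 0) :
    0 ≤ ∫ p, onPhase φ p * classicalTransportDeriv φ p ∂(phaseMeasure D) := by
  rw [integral_phaseMeasure_eq hD ((continuous_onPhase hφ.continuous).fun_mul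
      (continuous_classicalTransportDeriv hφ))]
  refine integral_nonneg fun s => ?_
  exact setIntegral_mul_fderiv_nonneg (φ := fun y => φ (y, (s : Space d))) hD
    (mem_sphere_zero_iff_norm.1 s.2) (hφ.comp (by fun_prop))
    fun y n hn hneg => h0 (y, s) ⟨n, hn, hneg⟩

/-- The flux of a `C¹`-function which vanishes at the outflow boundary is nonpositive. -/
theorem integral_classical_nonpos (hD : IsBoundedConvexDomain D) {φ : Space d × Space d → ℝ}
    (hφ : ContDiff ℝ 1 φ) (h0 : ∀ p ∈ outflow D, onPhase φ p = 0) :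
    ∫ p, onPhase φ p * classicalTransportDeriv φ p ∂(phaseMeasure D) ≤ 0 := by
  rw [integral_phaseMeasure_eq hD ((continuous_onPhase hφ.continuous).fun_mul
      (continuous_classicalTransportDeriv hφ))]
  refine integral_nonpos fun s => ?_
  have h := setIntegral_mul_fderiv_nonneg (φ := fun y => φ (y, (s : Space d)))
    (u := -(s : Space d)) hD (by rw [norm_neg]; exact mem_sphere_zero_iff_norm.1 s.2)
    (hφ.comp (by fun_prop)) fun y n hn hneg => h0 (y, s) ⟨n, hn, by
      rw [inner_neg_left] at hneg
      exact neg_lt_zero.1 hneg⟩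
  simp only [map_neg, mul_neg, integral_neg] at h
  exact neg_nonneg.1 h

theorem l2Norm_le_hNorm (w : Space d × Dir d → ℝ) :
    l2Norm D w ≤ hNorm D w ∧ l2Norm D (transportDeriv D w) ≤ hNorm D w := by
  have key : ∀ a : ℝ≥0∞, (a ^ 2) ^ (1 / 2 : ℝ) = a := fun a => by
    rw [← ENNReal.rpow_natCast, ← ENNReal.rpow_mul]
    norm_num
  constructor
  · rw [← key (l2Norm D w)]
    exact ENNReal.rpow_le_rpow le_add_self (by norm_num)
  · rw [← key (l2Norm D (transportDeriv D w))]
    exact ENNReal.rpow_le_rpow le_self_add (by norm_num)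

/-- A function in the closure is approximated, together with its transport derivative, by
`C¹`-functions with the prescribed boundary condition. -/
theorem MemHZero.mem_closure (hD : IsBoundedConvexDomain D) {Γ : Set (Space d × Dir d)}
    {w : Space d × Dir d → ℝ} (hw : MemHZero D Γ w) {A : Set (Lp ℝ 2 (phaseMeasure D) ×
      Lp ℝ 2 (phaseMeasure D))} (hA : IsClosed A)
    (h : ∀ (φ : Space d × Space d → ℝ) (hφ : ContDiff ℝ 1 φ), (∀ p ∈ Γ, onPhase φ p = 0) →
      ((memLp_of_continuous hD (continuous_onPhase hφ.continuous)).toLp _,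
        (memLp_of_continuous hD (continuous_classicalTransportDeriv hφ)).toLp _) ∈ A) :
    (hw.1.1.toLp w, hw.1.memLp_transportDeriv.toLp _) ∈ A := by
  rw [← hA.closure_eq, Metric.mem_closure_iff]
  intro ε hε
  obtain ⟨φ, hφ, h0, hlt⟩ := hw.2 (ENNReal.ofReal ε) (ENNReal.ofReal_pos.2 hε)
  refine ⟨_, h φ hφ h0, ?_⟩
  have hn := l2Norm_le_hNorm (D := D) fun p => w p - onPhase φ p
  rw [Prod.dist_eq, max_lt_iff, ← ENNReal.ofReal_lt_ofReal_iff hε, ← edist_dist,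
    ← ENNReal.ofReal_lt_ofReal_iff hε, ← edist_dist, Lp.edist_toLp_toLp, Lp.edist_toLp_toLp]
  refine ⟨hn.1.trans_lt hlt, lt_of_le_of_lt (le_of_eq ?_) (hn.2.trans_lt hlt)⟩
  exact eLpNorm_congr_ae (transportDeriv_sub_onPhase hD hw.1 hφ).symm

theorem inner_toLp_toLp {v w : Space d × Dir d → ℝ} (hv : MemLp v 2 (phaseMeasure D))
    (hw : MemLp w 2 (phaseMeasure D)) :
    ⟪hv.toLp v, hw.toLp w⟫ = ∫ p, v p * w p ∂(phaseMeasure D) := by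
  rw [L2.inner_def]
  refine integral_congr_ae ?_
  filter_upwards [hv.coeFn_toLp, hw.coeFn_toLp] with p h1 h2
  rw [h1, h2]
  simp [mul_comm]

/-- The transport operator is accretive on `H_{0,-}(D × S)`. -/
theorem MemHZeroMinus.inner_nonneg (hD : IsBoundedConvexDomain D) {w : Space d × Dir d → ℝ}
    (hw : MemHZeroMinus D w) :
    0 ≤ ⟪hw.1.1.toLp w, hw.1.memLp_transportDeriv.toLp _⟫ := by
  refine MemHZero.mem_closure hD hw (A := {q | 0 ≤ ⟪q.1, q.2⟫})
    (isClosed_le continuous_const (by fun_prop)) fun φ hφ h0 => ?_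
  rw [mem_ofPred_eq, inner_toLp_toLp]
  exact integral_classical_nonneg hD hφ h0

/-- The negative transport operator is accretive on `H_{0,+}(D × S)`. -/
theorem MemHZeroPlus.inner_nonpos (hD : IsBoundedConvexDomain D) {w : Space d × Dir d → ℝ}
    (hw : MemHZeroPlus D w) :
    ⟪hw.1.1.toLp w, hw.1.memLp_transportDeriv.toLp _⟫ ≤ 0 := by
  refine MemHZero.mem_closure hD hw (A := {q | ⟪q.1, q.2⟫ ≤ 0})
    (isClosed_le (by fun_prop) continuous_const) fun φ hφ h0 => ?_
  rw [mem_ofPred_eq, inner_toLp_toLp]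
  exact integral_classical_nonpos hD hφ h0

end Smooth

/-! ### The abstract Hilbert space estimate -/

section Hilbert

/-- A dissipative perturbation `G + S` controls both `G` and `W` if `S` is coercive and bounded
relative to `W`. -/
theorem norm_equiv_of_coercive {E : Type*} [NormedAddCommGroup E] [InnerProductSpace ℝ E]
    {W G S : E} {α R : ℝ} (hα : 0 < α) (hR : 0 ≤ R) (hGW : 0 ≤ ⟪W, G⟫)
    (hcoer : α * ‖W‖ ^ 2 ≤ ⟪W, S⟫) (hS : ‖S‖ ≤ R * ‖W‖) :
    √(‖G‖ ^ 2 + ‖W‖ ^ 2) ≤ (1 + (R + 1) / α) * ‖G + S‖ ∧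
      ‖G + S‖ ≤ (1 + R) * √(‖G‖ ^ 2 + ‖W‖ ^ 2) := by
  have hG := norm_nonneg G
  have hW := norm_nonneg W
  have hB := norm_nonneg (G + S)
  -- Cauchy-Schwarz in `α‖W‖² ≤ ⟪W, S⟫ ≤ ⟪W, G + S⟫`, divided by `‖W‖` when it is nonzero.
  have h1 : α * ‖W‖ ≤ ‖G + S‖ := by
    rcases hW.eq_or_lt with h | h
    · rw [← h, mul_zero]; exact hB
    · have := real_inner_le_norm W (G + S)
      rw [inner_add_right] at this
      by_contra hc
      push Not at hc
      nlinarith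
  have h2 : ‖W‖ ≤ ‖G + S‖ / α := (le_div_iff₀ hα).2 (by linarith)
  have h3 : ‖G‖ ≤ ‖G + S‖ + ‖S‖ := by simpa using norm_sub_le (G + S) S
  have h4 : R * ‖W‖ ≤ R * (‖G + S‖ / α) := mul_le_mul_of_nonneg_left h2 hR
  have h5 : ‖W‖ ≤ √(‖G‖ ^ 2 + ‖W‖ ^ 2) := Real.le_sqrt_of_sq_le (by nlinarith)
  have h6 : ‖G‖ ≤ √(‖G‖ ^ 2 + ‖W‖ ^ 2) := Real.le_sqrt_of_sq_le (by nlinarith)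
  have h7 : √(‖G‖ ^ 2 + ‖W‖ ^ 2) ≤ ‖G‖ + ‖W‖ :=
    (Real.sqrt_le_left (by positivity)).2 (by nlinarith)
  constructor
  · calc _ ≤ ‖G‖ + ‖W‖ := h7
      _ ≤ ‖G + S‖ + R * (‖G + S‖ / α) + ‖G + S‖ / α := by linarith
      _ = _ := by field_simp; ring
  · calc _ ≤ ‖G‖ + ‖S‖ := norm_add_le _ _
      _ ≤ _ := by nlinarith

end Hilbert

/-! ### Schur-type bounds for nonnegative kernels -/

section Schur

variable {X S : Type*} [MeasurableSpace X] [MeasurableSpace S]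

/-- The exchange `((x, a), b) ↦ ((x, b), a)` of the last two variables. -/
def swapLast (X S : Type*) [MeasurableSpace X] [MeasurableSpace S] :
    (X × S) × S ≃ᵐ (X × S) × S :=
  MeasurableEquiv.prodAssoc.trans
    (((MeasurableEquiv.refl X).prodCongr MeasurableEquiv.prodComm).trans
      MeasurableEquiv.prodAssoc.symm)

@[simp] theorem swapLast_apply (q : (X × S) × S) :
    swapLast X S q = ((q.1.1, q.2), q.1.2) := rfl

theorem measurePreserving_swapLast (μ : Measure X) (ν : Measure S) [SFinite μ] [SFinite ν] :
    MeasurePreserving (swapLast X S) ((μ.prod ν).prod ν) ((μ.prod ν).prod ν) :=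
  ((measurePreserving_prodAssoc μ ν ν).symm _).comp
    (((MeasurePreserving.id μ).prod Measure.measurePreserving_swap).comp
      (measurePreserving_prodAssoc μ ν ν))

variable {μ : Measure X} {ν : Measure S} [SFinite μ]

theorem ae_aemeasurable_slice [SFinite ν] {Y : Type*} [MeasurableSpace Y] {ρ : Measure Y}
    {k : Y × S → ℝ≥0∞} (hk : AEMeasurable k (ρ.prod ν)) :
    ∀ᵐ p ∂ρ, AEMeasurable (fun a => k (p, a)) ν :=
  hk.aestronglyMeasurable.prodMk_left.mono fun _ h => h.aemeasurable

/-- Tonelli after exchanging the two directions; this turns an integral against one marginal into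
one against the other. -/
theorem lintegral_lintegral_swapLast [SFinite ν] {k : (X × S) × S → ℝ≥0∞} {f : X × S → ℝ≥0∞}
    (hk : AEMeasurable k ((μ.prod ν).prod ν)) (hf : AEMeasurable f (μ.prod ν)) :
    ∫⁻ p, ∫⁻ a, k ((p.1, a), p.2) * f (p.1, a) ∂ν ∂(μ.prod ν) =
      ∫⁻ p, (∫⁻ b, k (p, b) ∂ν) * f p ∂(μ.prod ν) := by
  have hs := measurePreserving_swapLast μ ν
  have hkf : AEMeasurable (fun q : (X × S) × S => k q * f q.1) ((μ.prod ν).prod ν) :=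
    hk.mul (hf.comp_quasiMeasurePreserving Measure.quasiMeasurePreserving_fst)
  have h1 := hs.lintegral_comp_emb (swapLast X S).measurableEmbedding fun q => k q * f q.1
  have h2 := lintegral_prod _ (hkf.comp_quasiMeasurePreserving hs.quasiMeasurePreserving)
  simp only [Function.comp_def] at h2
  rw [h2, lintegral_prod _ hkf] at h1
  simp only [swapLast_apply] at h1
  rw [h1]
  refine lintegral_congr_ae ?_
  filter_upwards [ae_aemeasurable_slice hk] with p hp
  exact lintegral_mul_const'' _ hp

theorem two_mul_mul_le_sq_add_sq (x y : ℝ≥0∞) : 2 * (x * y) ≤ x ^ 2 + y ^ 2 := by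
  rcases le_total x y with h | h
  · obtain ⟨z, rfl⟩ := exists_add_of_le h
    calc 2 * (x * (x + z)) ≤ 2 * (x * (x + z)) + z ^ 2 := le_self_add
      _ = _ := by ring
  · obtain ⟨z, rfl⟩ := exists_add_of_le h
    calc 2 * ((y + z) * y) ≤ 2 * ((y + z) * y) + z ^ 2 := le_self_add
      _ = _ := by ring

/-- The weighted Cauchy-Schwarz inequality. -/
theorem lintegral_mul_sq_le {k v : S → ℝ≥0∞} (hk : AEMeasurable k ν) (hv : AEMeasurable v ν) :
    (∫⁻ a, k a * v a ∂ν) ^ 2 ≤ (∫⁻ a, k a ∂ν) * ∫⁻ a, k a * v a ^ 2 ∂ν := by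
  -- Split `k v` as `k^{1/2}` times `k^{1/2} v`.
  have h := ENNReal.lintegral_mul_le_Lp_mul_Lq ν Real.HolderConjugate.two_two
    (f := fun a => k a ^ (1 / 2 : ℝ)) (g := fun a => k a ^ (1 / 2 : ℝ) * v a)
    (hk.pow_const _) ((hk.pow_const _).mul hv)
  have e1 : ∀ a, ((fun a => k a ^ (1 / 2 : ℝ)) * fun a => k a ^ (1 / 2 : ℝ) * v a) a
      = k a * v a := fun a => by
    simp only [Pi.mul_apply]
    rw [← mul_assoc, ← ENNReal.rpow_add_of_nonneg _ _ (by norm_num) (by norm_num)]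
    norm_num
  have e2 : ∀ x : ℝ≥0∞, (x ^ (1 / 2 : ℝ)) ^ (2 : ℝ) = x := fun x => by
    rw [← ENNReal.rpow_mul]; norm_num
  simp only [e1, ENNReal.mul_rpow_of_nonneg _ _ (zero_le_two : (0 : ℝ) ≤ 2), e2] at h
  have h2 := ENNReal.rpow_le_rpow h (zero_le_two : (0 : ℝ) ≤ 2)
  rw [ENNReal.mul_rpow_of_nonneg _ _ (zero_le_two : (0 : ℝ) ≤ 2), e2, e2] at h2
  simpa only [ENNReal.rpow_two] using h2

variable [SFinite ν] {k : (X × S) × S → ℝ≥0∞} {f : X × S → ℝ≥0∞}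

/-- The Schur test. -/
theorem lintegral_schur_sq_le (hk : AEMeasurable k ((μ.prod ν).prod ν))
    (hf : AEMeasurable f (μ.prod ν)) {R : ℝ≥0∞}
    (h1 : ∀ᵐ p ∂(μ.prod ν), ∫⁻ b, k (p, b) ∂ν ≤ R)
    (h2 : ∀ᵐ p ∂(μ.prod ν), ∫⁻ a, k ((p.1, a), p.2) ∂ν ≤ R) :
    ∫⁻ p, (∫⁻ a, k ((p.1, a), p.2) * f (p.1, a) ∂ν) ^ 2 ∂(μ.prod ν) ≤
      R ^ 2 * ∫⁻ p, f p ^ 2 ∂(μ.prod ν) := by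
  have hs := (measurePreserving_swapLast μ ν).quasiMeasurePreserving
  have hk' := hk.comp_quasiMeasurePreserving hs
  have hf' := (hf.comp_quasiMeasurePreserving
    (Measure.quasiMeasurePreserving_fst (ν := ν))).comp_quasiMeasurePreserving hs
  have hkf' : AEMeasurable (fun q : (X × S) × S => k ((q.1.1, q.2), q.1.2) * f (q.1.1, q.2) ^ 2)
    ((μ.prod ν).prod ν) := hk'.mul (hf'.pow_const 2)
  -- Each marginal contributes one factor `R`: one through the weighted Cauchy-Schwarz inequality,
  -- the other after Tonelli.
  calc ∫⁻ p, (∫⁻ a, k ((p.1, a), p.2) * f (p.1, a) ∂ν) ^ 2 ∂(μ.prod ν)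
      ≤ ∫⁻ p, R * ∫⁻ a, k ((p.1, a), p.2) * f (p.1, a) ^ 2 ∂ν ∂(μ.prod ν) := by
        refine lintegral_mono_ae ?_
        filter_upwards [h2, ae_aemeasurable_slice hk', ae_aemeasurable_slice hf'] with p hp hkp hfp
        exact (lintegral_mul_sq_le hkp hfp).trans (mul_le_mul_left hp _)
    _ = R * ∫⁻ p, (∫⁻ b, k (p, b) ∂ν) * f p ^ 2 ∂(μ.prod ν) := by
        rw [lintegral_const_mul'' _ hkf'.lintegral_prod_right',
          lintegral_lintegral_swapLast hk (hf.pow_const 2)]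
    _ ≤ R * ∫⁻ p, R * f p ^ 2 ∂(μ.prod ν) := by
        refine mul_le_mul_right (lintegral_mono_ae ?_) _
        filter_upwards [h1] with p hp
        exact mul_le_mul_left hp _
    _ = R ^ 2 * ∫⁻ p, f p ^ 2 ∂(μ.prod ν) := by
        rw [lintegral_const_mul'' _ (hf.pow_const 2)]
        ring

/-- The quadratic form of a nonnegative kernel is bounded by its marginals. -/
theorem lintegral_quadratic_le (hk : AEMeasurable k ((μ.prod ν).prod ν))
    (hf : AEMeasurable f (μ.prod ν)) {c : X × S → ℝ≥0∞}
    (h1 : ∀ᵐ p ∂(μ.prod ν), ∫⁻ b, k (p, b) ∂ν ≤ c p)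
    (h2 : ∀ᵐ p ∂(μ.prod ν), ∫⁻ a, k ((p.1, a), p.2) ∂ν ≤ c p) :
    ∫⁻ p, f p * ∫⁻ a, k ((p.1, a), p.2) * f (p.1, a) ∂ν ∂(μ.prod ν) ≤
      ∫⁻ p, c p * f p ^ 2 ∂(μ.prod ν) := by
  have hs := (measurePreserving_swapLast μ ν).quasiMeasurePreserving
  have hk' := hk.comp_quasiMeasurePreserving hs
  have hf' := (hf.comp_quasiMeasurePreserving
    (Measure.quasiMeasurePreserving_fst (ν := ν))).comp_quasiMeasurePreserving hs
  have hkf' : AEMeasurable (fun q : (X × S) × S => k ((q.1.1, q.2), q.1.2) * f (q.1.1, q.2) ^ 2)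
    ((μ.prod ν).prod ν) := hk'.mul (hf'.pow_const 2)
  have hkf : AEMeasurable (fun q : (X × S) × S => k ((q.1.1, q.2), q.1.2) * f (q.1.1, q.2))
    ((μ.prod ν).prod ν) := hk'.mul hf'
  -- The doubled form lets `2ab ≤ a² + b²` be used without division. The `f p ^ 2` term meets the
  -- marginal in `h2` directly; the other square meets the marginal in `h1` after the swap.
  have key : ∫⁻ p, 2 * (f p * ∫⁻ a, k ((p.1, a), p.2) * f (p.1, a) ∂ν) ∂(μ.prod ν) ≤
      2 * ∫⁻ p, c p * f p ^ 2 ∂(μ.prod ν) := by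
    calc ∫⁻ p, 2 * (f p * ∫⁻ a, k ((p.1, a), p.2) * f (p.1, a) ∂ν) ∂(μ.prod ν)
        ≤ ∫⁻ p, ((∫⁻ a, k ((p.1, a), p.2) * f (p.1, a) ^ 2 ∂ν) + c p * f p ^ 2) ∂(μ.prod ν) := by
          refine lintegral_mono_ae ?_
          filter_upwards [h2, ae_aemeasurable_slice hk', ae_aemeasurable_slice hf'] with p hp hkp hfp
          have hm : AEMeasurable (fun a => k ((p.1, a), p.2)) ν := hkp
          have hm2 : AEMeasurable (fun a => k ((p.1, a), p.2) * f (p.1, a) ^ 2) ν :=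
            hm.mul (hfp.pow_const 2)
          have hm1 : AEMeasurable (fun a => k ((p.1, a), p.2) * f (p.1, a)) ν := hm.mul hfp
          calc 2 * (f p * ∫⁻ a, k ((p.1, a), p.2) * f (p.1, a) ∂ν)
              = ∫⁻ a, (2 * f p) * (k ((p.1, a), p.2) * f (p.1, a)) ∂ν := by
                rw [lintegral_const_mul'' _ hm1, mul_assoc]
            _ ≤ ∫⁻ a, (k ((p.1, a), p.2) * f (p.1, a) ^ 2 + k ((p.1, a), p.2) * f p ^ 2) ∂ν := by
                refine lintegral_mono fun a => ?_
                calc (2 * f p) * (k ((p.1, a), p.2) * f (p.1, a))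
                    = k ((p.1, a), p.2) * (2 * (f (p.1, a) * f p)) := by ring
                  _ ≤ k ((p.1, a), p.2) * (f (p.1, a) ^ 2 + f p ^ 2) :=
                    mul_le_mul_right (two_mul_mul_le_sq_add_sq _ _) _
                  _ = _ := mul_add _ _ _
            _ = (∫⁻ a, k ((p.1, a), p.2) * f (p.1, a) ^ 2 ∂ν)
                  + (∫⁻ a, k ((p.1, a), p.2) ∂ν) * f p ^ 2 := by
                rw [lintegral_add_left' hm2, lintegral_mul_const'' _ hm]
            _ ≤ _ := by gcongr
      _ = ∫⁻ p, (∫⁻ b, k (p, b) ∂ν) * f p ^ 2 ∂(μ.prod ν) +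
            ∫⁻ p, c p * f p ^ 2 ∂(μ.prod ν) := by
          rw [lintegral_add_left' hkf'.lintegral_prod_right',
            lintegral_lintegral_swapLast hk (hf.pow_const 2)]
      _ ≤ ∫⁻ p, c p * f p ^ 2 ∂(μ.prod ν) + ∫⁻ p, c p * f p ^ 2 ∂(μ.prod ν) := by
          gcongr ?_ + _
          refine lintegral_mono_ae ?_
          filter_upwards [h1] with p hp
          exact mul_le_mul_left hp _
      _ = _ := (two_mul _).symm
  rw [lintegral_const_mul'' _ (hf.fun_mul hkf.lintegral_prod_right')] at key
  exact (ENNReal.mul_le_mul_iff_right two_ne_zero ENNReal.ofNat_ne_top).1 key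

end Schur

/-! ### The collision operator in `L₂` -/

section Collision

variable {d : ℕ} {D : Set (Space d)} {K : Space d × Dir d × Dir d → ℝ}

/-- The kernel with exchanged directions. -/
def swapKernel (K : Space d × Dir d × Dir d → ℝ) (q : Space d × Dir d × Dir d) : ℝ :=
  K (q.1, q.2.2, q.2.1)

theorem measurePreserving_swapDirections (D : Set (Space d)) :
    MeasurePreserving (Prod.map id Prod.swap : Space d × Dir d × Dir d → Space d × Dir d × Dir d)
      ((volume.restrict D).prod ((dirMeasure d).prod (dirMeasure d)))
      ((volume.restrict D).prod ((dirMeasure d).prod (dirMeasure d))) :=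
  (MeasurePreserving.id _).prod Measure.measurePreserving_swap

/-- `kernelAvg' K` and `collisionAdj K` are by definition `kernelAvg` and `collision` of `swapKernel
K`, so every estimate transfers. -/
theorem KernelAssumption.swap (hK : KernelAssumption D K) : KernelAssumption D (swapKernel K) where
  measurable := hK.measurable.comp_measurePreserving (measurePreserving_swapDirections D)
  nonneg := (measurePreserving_swapDirections D).quasiMeasurePreserving.ae hK.nonneg
  bounded := by
    obtain ⟨M, hM⟩ := hK.bounded
    refine ⟨M, ?_⟩
    filter_upwards [hM, hK.measurable.prodMk_left] with x hx hxm
    exact (eLpNorm_comp_measurePreserving hxm Measure.measurePreserving_swap).trans_le hx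

theorem KernelAssumption.integrable (hD : IsBoundedConvexDomain D) (hK : KernelAssumption D K) :
    Integrable K ((volume.restrict D).prod ((dirMeasure d).prod (dirMeasure d))) := by
  have := hD.isFiniteMeasure_restrict
  refine ⟨hK.measurable, ?_⟩
  obtain ⟨M, hM⟩ := hK.bounded
  rw [HasFiniteIntegral, lintegral_prod _ hK.measurable.enorm]
  set c : ℝ≥0∞ := ((dirMeasure d).prod (dirMeasure d)) univ ^
    (1 / (1 : ℝ≥0∞).toReal - 1 / (2 : ℝ≥0∞).toReal) with hc
  have hct : c < ⊤ := ENNReal.rpow_lt_top_of_nonneg (by norm_num) (measure_ne_top _ _)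
  calc _ ≤ ∫⁻ _, M * c ∂(volume.restrict D) := by
        refine lintegral_mono_ae ?_
        filter_upwards [hM, hK.measurable.prodMk_left] with x hx hxm
        rw [← eLpNorm_one_eq_lintegral_enorm]
        exact (eLpNorm_le_eLpNorm_mul_rpow_measure_univ (by norm_num) hxm).trans
          (mul_le_mul_left hx _)
    _ < ⊤ := by
        rw [lintegral_const]
        exact ENNReal.mul_lt_top (ENNReal.mul_lt_top ENNReal.coe_lt_top hct) (measure_lt_top _ _)

theorem KernelAssumption.integrable_assoc (hD : IsBoundedConvexDomain D)
    (hK : KernelAssumption D K) :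
    Integrable (fun q : (Space d × Dir d) × Dir d => K (q.1.1, q.1.2, q.2))
      ((phaseMeasure D).prod (dirMeasure d)) :=
  ((measurePreserving_prodAssoc (volume.restrict D) (dirMeasure d)
    (dirMeasure d)).integrable_comp_emb MeasurableEquiv.prodAssoc.measurableEmbedding).2
      (hK.integrable hD)

/-- Integrability of almost every slice rules out the default value `0` of the Bochner integral, so
bounds on `kernelAvg` really bound the kernel's marginals. -/
theorem KernelAssumption.ae_kernelAvg (hD : IsBoundedConvexDomain D) (hK : KernelAssumption D K) :
    ∀ᵐ p ∂(phaseMeasure D), 0 ≤ kernelAvg K p ∧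
      ∫⁻ s, ‖K (p.1, p.2, s)‖ₑ ∂(dirMeasure d) = ENNReal.ofReal (kernelAvg K p) := by
  have := hD.isFiniteMeasure_phaseMeasure
  have h0 : ∀ᵐ q ∂((phaseMeasure D).prod (dirMeasure d)), 0 ≤ K (q.1.1, q.1.2, q.2) :=
    (measurePreserving_prodAssoc (volume.restrict D) (dirMeasure d)
      (dirMeasure d)).quasiMeasurePreserving.ae hK.nonneg
  filter_upwards [Measure.ae_ae_of_ae_prod h0, (hK.integrable_assoc hD).prod_right_ae] with p hp hi
  refine ⟨integral_nonneg_of_ae hp, ?_⟩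
  rw [kernelAvg, ofReal_integral_eq_lintegral_ofReal hi hp]
  refine lintegral_congr_ae ?_
  filter_upwards [hp] with s hs
  exact Real.enorm_of_nonneg hs

theorem eLpNorm_two_sq {Y : Type*} [MeasurableSpace Y] (ρ : Measure Y) (f : Y → ℝ) :
    eLpNorm f 2 ρ ^ 2 = ∫⁻ y, ‖f y‖ₑ ^ 2 ∂ρ := by
  simpa using eLpNorm_nnreal_pow_eq_lintegral (f := f) (μ := ρ) (p := 2) two_ne_zero

variable {w : Space d × Dir d → ℝ}

theorem enorm_collision_le (p : Space d × Dir d) :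
    ‖collision K w p‖ₑ ≤
      ∫⁻ s, ‖K (p.1, s, p.2)‖ₑ * ‖w (p.1, s)‖ₑ ∂(dirMeasure d) := by
  simp only [← enorm_mul]
  exact enorm_integral_le_lintegral_enorm _

theorem aestronglyMeasurable_collision (hD : IsBoundedConvexDomain D) (hK : KernelAssumption D K)
    (hw : AEStronglyMeasurable w (phaseMeasure D)) :
    AEStronglyMeasurable (collision K w) (phaseMeasure D) := by
  have h := (hK.integrable_assoc hD).aestronglyMeasurable.mul
    (hw.comp_quasiMeasurePreserving
      (Measure.quasiMeasurePreserving_fst (μ := phaseMeasure D) (ν := dirMeasure d)))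
  exact (h.comp_measurePreserving
    (measurePreserving_swapLast (volume.restrict D) (dirMeasure d))).integral_prod_right'

/-- The collision operator is bounded in `L₂` by the essential supremum of the marginals. -/
theorem eLpNorm_collision_le (hD : IsBoundedConvexDomain D) (hK : KernelAssumption D K)
    (hw : AEStronglyMeasurable w (phaseMeasure D)) {R : ℝ}
    (h1 : ∀ᵐ p ∂(phaseMeasure D), kernelAvg K p ≤ R)
    (h2 : ∀ᵐ p ∂(phaseMeasure D), kernelAvg' K p ≤ R) :
    eLpNorm (collision K w) 2 (phaseMeasure D) ≤
      ENNReal.ofReal R * eLpNorm w 2 (phaseMeasure D) := by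
  rw [← ENNReal.pow_le_pow_left_iff two_ne_zero, mul_pow, eLpNorm_two_sq, eLpNorm_two_sq]
  refine (lintegral_mono fun p => pow_le_pow_left' (enorm_collision_le p) 2).trans ?_
  refine lintegral_schur_sq_le (k := fun q => ‖K (q.1.1, q.1.2, q.2)‖ₑ)
    (hK.integrable_assoc hD).aestronglyMeasurable.enorm hw.enorm ?_ ?_
  · filter_upwards [hK.ae_kernelAvg hD, h1] with p hp h
    exact hp.2.trans_le (ENNReal.ofReal_le_ofReal h)
  · filter_upwards [hK.swap.ae_kernelAvg hD, h2] with p hp h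
    exact hp.2.trans_le (ENNReal.ofReal_le_ofReal h)

/-- The quadratic form of the collision operator is bounded by the marginals of the kernel. -/
theorem integral_mul_collision_le (hD : IsBoundedConvexDomain D) (hK : KernelAssumption D K)
    (hw : AEStronglyMeasurable w (phaseMeasure D)) {c : Space d × Dir d → ℝ}
    (hcw : Integrable (fun p => c p * w p ^ 2) (phaseMeasure D))
    (h1 : ∀ᵐ p ∂(phaseMeasure D), kernelAvg K p ≤ c p)
    (h2 : ∀ᵐ p ∂(phaseMeasure D), kernelAvg' K p ≤ c p) :
    ∫ p, w p * collision K w p ∂(phaseMeasure D) ≤ ∫ p, c p * w p ^ 2 ∂(phaseMeasure D) := by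
  have hc0 : ∀ᵐ p ∂(phaseMeasure D), 0 ≤ c p := by
    filter_upwards [hK.ae_kernelAvg hD, h1] with p hp h
    exact hp.1.trans h
  have hcw0 : ∀ᵐ p ∂(phaseMeasure D), 0 ≤ c p * w p ^ 2 := by
    filter_upwards [hc0] with p hp
    positivity
  have key : ∫⁻ p, ‖w p * collision K w p‖ₑ ∂(phaseMeasure D) ≤
      ENNReal.ofReal (∫ p, c p * w p ^ 2 ∂(phaseMeasure D)) := by
    rw [ofReal_integral_eq_lintegral_ofReal hcw hcw0]
    calc _ ≤ ∫⁻ p, ‖w p‖ₑ * ∫⁻ s, ‖K (p.1, s, p.2)‖ₑ * ‖w (p.1, s)‖ₑ ∂(dirMeasure d)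
            ∂(phaseMeasure D) := by
          refine lintegral_mono fun p => ?_
          rw [enorm_mul]
          exact mul_le_mul_right (enorm_collision_le p) _
      _ ≤ ∫⁻ p, ENNReal.ofReal (c p) * ‖w p‖ₑ ^ 2 ∂(phaseMeasure D) := by
          refine lintegral_quadratic_le (k := fun q => ‖K (q.1.1, q.1.2, q.2)‖ₑ)
            (hK.integrable_assoc hD).aestronglyMeasurable.enorm hw.enorm ?_ ?_
          · filter_upwards [hK.ae_kernelAvg hD, h1] with p hp h
            exact hp.2.trans_le (ENNReal.ofReal_le_ofReal h)
          · filter_upwards [hK.swap.ae_kernelAvg hD, h2] with p hp h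
            exact hp.2.trans_le (ENNReal.ofReal_le_ofReal h)
      _ = _ := by
          refine lintegral_congr_ae ?_
          filter_upwards [hc0] with p hp
          rw [ENNReal.ofReal_mul hp, ← Real.enorm_of_nonneg (sq_nonneg (w p)), enorm_pow]
  have h3 := (enorm_integral_le_lintegral_enorm _).trans key
  rw [Real.enorm_eq_ofReal_abs, ENNReal.ofReal_le_ofReal_iff (integral_nonneg_of_ae hcw0)] at h3
  exact (le_abs_self _).trans h3

end Collision

/-! ### Coercivity of the zero order part and the norm equivalences -/

section Equivalence

variable {d : ℕ} {D : Set (Space d)} {K : Space d × Dir d × Dir d → ℝ}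
  {σ w g : Space d × Dir d → ℝ} {α σmax : ℝ}

theorem hNorm_eq_ofReal {w : Space d × Dir d → ℝ} (hw : MemH D w) :
    hNorm D w = ENNReal.ofReal √(‖hw.memLp_transportDeriv.toLp _‖ ^ 2 + ‖hw.1.toLp w‖ ^ 2) := by
  have h1 : l2Norm D (transportDeriv D w) = ENNReal.ofReal ‖hw.memLp_transportDeriv.toLp _‖ := by
    rw [Lp.norm_toLp, ENNReal.ofReal_toReal hw.memLp_transportDeriv.2.ne, l2Norm]
  have h2 : l2Norm D w = ENNReal.ofReal ‖hw.1.toLp w‖ := by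
    rw [Lp.norm_toLp, ENNReal.ofReal_toReal hw.1.2.ne, l2Norm]
  rw [hNorm, h1, h2, ← ENNReal.ofReal_pow (norm_nonneg _), ← ENNReal.ofReal_pow (norm_nonneg _),
    ← ENNReal.ofReal_add (by positivity) (by positivity),
    ENNReal.ofReal_rpow_of_nonneg (by positivity) (by norm_num), Real.sqrt_eq_rpow]

theorem memLp_mul_crossSection (hσ : CrossSectionAssumption D σ σmax)
    (hw : MemLp w 2 (phaseMeasure D)) : MemLp (fun p => σ p * w p) 2 (phaseMeasure D) ∧
      eLpNorm (fun p => σ p * w p) 2 (phaseMeasure D) ≤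
        ENNReal.ofReal |σmax| * eLpNorm w 2 (phaseMeasure D) := by
  have hb : ∀ᵐ p ∂(phaseMeasure D), ‖σ p * w p‖ ≤ |σmax| * ‖w p‖ := by
    filter_upwards [hσ.nonneg, hσ.bounded] with p h0 h1
    rw [norm_mul, Real.norm_of_nonneg h0]
    exact mul_le_mul_of_nonneg_right (h1.trans (le_abs_self _)) (norm_nonneg _)
  exact ⟨hw.of_le_mul (hσ.measurable.mul hw.1) hb, eLpNorm_le_mul_eLpNorm_of_ae_le_mul hb 2⟩

/-- The zero order part `σ w - 𝒦 w` of the transfer operator is coercive and bounded in `L₂`, and so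
is `σ w`. -/
theorem zeroOrder_bounds (hD : IsBoundedConvexDomain D) (hσ : CrossSectionAssumption D σ σmax)
    (hK : KernelAssumption D K) (gap : ∀ᵐ p ∂(phaseMeasure D), α ≤ σ p - kernelAvg K p)
    (gap' : ∀ᵐ p ∂(phaseMeasure D), α ≤ σ p - kernelAvg' K p) (hα : 0 < α)
    (hw : MemLp w 2 (phaseMeasure D)) :
    ∃ (hB : MemLp (fun p => σ p * w p - collision K w p) 2 (phaseMeasure D))
      (hT : MemLp (fun p => σ p * w p) 2 (phaseMeasure D)),
      (α * ‖hw.toLp w‖ ^ 2 ≤ ⟪hw.toLp w, hB.toLp _⟫ ∧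
        ‖hB.toLp _‖ ≤ (2 * |σmax|) * ‖hw.toLp w‖) ∧
      (α * ‖hw.toLp w‖ ^ 2 ≤ ⟪hw.toLp w, hT.toLp _⟫ ∧
        ‖hT.toLp _‖ ≤ (2 * |σmax|) * ‖hw.toLp w‖) := by
  obtain ⟨hT, hTn⟩ := memLp_mul_crossSection hσ hw
  have h1 : ∀ᵐ p ∂(phaseMeasure D), kernelAvg K p ≤ σ p - α := gap.mono fun p h => by linarith
  have h2 : ∀ᵐ p ∂(phaseMeasure D), kernelAvg' K p ≤ σ p - α := gap'.mono fun p h => by linarith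
  -- The gap conditions give marginals at most `σ - α ≤ |σmax|`; the absolute value keeps the
  -- constant nonnegative.
  have hCn := eLpNorm_collision_le (R := |σmax|) hD hK hw.1
    (by filter_upwards [h1, hσ.bounded] with p h h'; linarith [le_abs_self σmax])
    (by filter_upwards [h2, hσ.bounded] with p h h'; linarith [le_abs_self σmax])
  have hC : MemLp (collision K w) 2 (phaseMeasure D) :=
    ⟨aestronglyMeasurable_collision hD hK hw.1,
      hCn.trans_lt (ENNReal.mul_lt_top ENNReal.ofReal_lt_top hw.2)⟩
  have hreal : ∀ {f : Space d × Dir d → ℝ} (hf : MemLp f 2 (phaseMeasure D)),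
      eLpNorm f 2 (phaseMeasure D) ≤ ENNReal.ofReal |σmax| * eLpNorm w 2 (phaseMeasure D) →
      ‖hf.toLp f‖ ≤ |σmax| * ‖hw.toLp w‖ := fun hf h => by
    have := ENNReal.toReal_mono (ENNReal.mul_ne_top ENNReal.ofReal_ne_top hw.2.ne) h
    rwa [ENNReal.toReal_mul, ENNReal.toReal_ofReal (abs_nonneg _), ← Lp.norm_toLp _ hf,
      ← Lp.norm_toLp _ hw] at this
  have hWW : ‖hw.toLp w‖ ^ 2 = ∫ p, w p ^ 2 ∂(phaseMeasure D) := by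
    rw [← real_inner_self_eq_norm_sq, inner_toLp_toLp]
    simp only [sq]
  have hi1 : Integrable (fun p => w p ^ 2) (phaseMeasure D) := hw.integrable_sq
  have hi2 : Integrable (fun p => w p * (σ p * w p)) (phaseMeasure D) := hw.integrable_mul hT
  have hi3 : Integrable (fun p => (σ p - α) * w p ^ 2) (phaseMeasure D) :=
    (hi2.sub (hi1.const_mul α)).congr (Eventually.of_forall fun p => by
      simp only [Pi.sub_apply]; ring)
  have hform := integral_mul_collision_le hD hK hw.1 hi3 h1 h2
  have hsplit : ∫ p, (σ p - α) * w p ^ 2 ∂(phaseMeasure D) =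
      ⟪hw.toLp w, hT.toLp _⟫ - α * ‖hw.toLp w‖ ^ 2 := by
    rw [inner_toLp_toLp, hWW, ← integral_const_mul, ← integral_sub hi2 (hi1.const_mul α)]
    congr 1 with p
    ring
  -- Since `σ - α` dominates the nonnegative `σ̄`, multiplication by `σ` alone is coercive with the
  -- same constant.
  have hσα : ∀ᵐ p ∂(phaseMeasure D), 0 ≤ (σ p - α) * w p ^ 2 := by
    filter_upwards [hK.ae_kernelAvg hD, h1] with p hp h
    exact mul_nonneg (hp.1.trans h) (sq_nonneg _)
  have hW := norm_nonneg (hw.toLp w)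
  have hBeq : (hT.sub hC).toLp _ = hT.toLp _ - hC.toLp _ := MemLp.toLp_sub hT hC
  refine ⟨hT.sub hC, hT, ⟨?_, ?_⟩, ?_, ?_⟩
  · rw [← inner_toLp_toLp hw hC, hsplit] at hform
    change _ ≤ ⟪_, (hT.sub hC).toLp _⟫
    rw [hBeq, inner_sub_right]
    linarith
  · change ‖(hT.sub hC).toLp _‖ ≤ _
    rw [hBeq]
    linarith [norm_sub_le (hT.toLp _) (hC.toLp _), hreal hT hTn, hreal hC hCn]
  · linarith [integral_nonneg_of_ae hσα, hsplit]
  · nlinarith [hreal hT hTn, abs_nonneg σmax]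

/-- The constant in the norm equivalences. -/
def equivConst (α σmax : ℝ) : ℝ := 1 + (2 * |σmax| + 1) / α + 2 * |σmax|

/-- The norm equivalences for an operator with accretive first order part `g`. -/
theorem equivWith_of_accretive (hD : IsBoundedConvexDomain D)
    (hσ : CrossSectionAssumption D σ σmax) (hK : KernelAssumption D K)
    (gap : ∀ᵐ p ∂(phaseMeasure D), α ≤ σ p - kernelAvg K p)
    (gap' : ∀ᵐ p ∂(phaseMeasure D), α ≤ σ p - kernelAvg' K p) (hα : 0 < α)
    (hw : MemH D w) (hg : MemLp g 2 (phaseMeasure D))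
    (hgn : ‖hg.toLp g‖ = ‖hw.memLp_transportDeriv.toLp _‖)
    (hacc : 0 ≤ ⟪hw.1.toLp w, hg.toLp g⟫) :
    MemLp (fun p => g p + σ p * w p - collision K w p) 2 (phaseMeasure D) ∧
    MemLp (fun p => g p + σ p * w p) 2 (phaseMeasure D) ∧
    EquivWith (equivConst α σmax ^ 2).toNNReal (hNorm D w)
      (l2Norm D fun p => g p + σ p * w p - collision K w p) ∧
    EquivWith (equivConst α σmax ^ 2).toNNReal
      (l2Norm D fun p => g p + σ p * w p - collision K w p)
      (l2Norm D fun p => g p + σ p * w p) := by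
  obtain ⟨hB, hT, ⟨hB1, hB2⟩, hT1, hT2⟩ := zeroOrder_bounds hD hσ hK gap gap' hα hw.1
  have hR : 0 ≤ 2 * |σmax| := by positivity
  have eB := norm_equiv_of_coercive hα hR hacc hB1 hB2
  have eT := norm_equiv_of_coercive hα hR hacc hT1 hT2
  rw [← MemLp.toLp_add, hgn] at eB eT
  have hfB : g + (fun p => σ p * w p - collision K w p) =
      fun p => g p + σ p * w p - collision K w p := by
    ext p; simp only [Pi.add_apply]; ring
  have hBm : MemLp (fun p => g p + σ p * w p - collision K w p) 2 (phaseMeasure D) :=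
    hfB ▸ hg.add hB
  have hTm : MemLp (fun p => g p + σ p * w p) 2 (phaseMeasure D) := hg.add hT
  have nB : l2Norm D (fun p => g p + σ p * w p - collision K w p) =
      ENNReal.ofReal ‖(hg.add hB).toLp _‖ := by
    rw [Lp.norm_toLp, ENNReal.ofReal_toReal (hg.add hB).2.ne, l2Norm, hfB]
  have nT : l2Norm D (fun p => g p + σ p * w p) = ENNReal.ofReal ‖(hg.add hT).toLp _‖ := by
    rw [Lp.norm_toLp, ENNReal.ofReal_toReal (hg.add hT).2.ne, l2Norm]
    rfl
  rw [nB, nT, hNorm_eq_ofReal hw]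
  set h := √(‖hw.memLp_transportDeriv.toLp _‖ ^ 2 + ‖hw.1.toLp w‖ ^ 2)
  set b := ‖(hg.add hB).toLp _‖
  set t := ‖(hg.add hT).toLp _‖
  have hh : 0 ≤ h := Real.sqrt_nonneg _
  have hb : 0 ≤ b := norm_nonneg _
  have ht : 0 ≤ t := norm_nonneg _
  set C := equivConst α σmax with hC
  have hq : 0 ≤ (2 * |σmax| + 1) / α := by positivity
  have hC1 : 1 ≤ C := by rw [hC, equivConst]; linarith
  have hCa : 1 + (2 * |σmax| + 1) / α ≤ C := by rw [hC, equivConst]; linarith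
  have hCb : 1 + 2 * |σmax| ≤ C := by rw [hC, equivConst]; linarith
  have hC0 : 0 ≤ C := by linarith
  -- Comparing `b` with `t` passes through `h` and costs `C` twice; as `C ≥ 1`, the square serves
  -- all four inequalities.
  have hCC : C ≤ C ^ 2 := by nlinarith
  have toE : ∀ x y : ℝ, x ≤ C ^ 2 * y →
      ENNReal.ofReal x ≤ ((C ^ 2).toNNReal : ℝ≥0∞) * ENNReal.ofReal y := fun x y hxy => by
    change _ ≤ ENNReal.ofReal (C ^ 2) * _
    rw [← ENNReal.ofReal_mul (by positivity)]
    exact ENNReal.ofReal_le_ofReal hxy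
  have b1 : h ≤ C * b := eB.1.trans (mul_le_mul_of_nonneg_right hCa hb)
  have b2 : b ≤ C * h := eB.2.trans (mul_le_mul_of_nonneg_right hCb hh)
  have t1 : h ≤ C * t := eT.1.trans (mul_le_mul_of_nonneg_right hCa ht)
  have t2 : t ≤ C * h := eT.2.trans (mul_le_mul_of_nonneg_right hCb hh)
  refine ⟨hBm, hTm, ⟨toE _ _ ?_, toE _ _ ?_⟩, ⟨toE _ _ ?_, toE _ _ ?_⟩⟩
  · exact b1.trans (mul_le_mul_of_nonneg_right hCC hb)
  · exact b2.trans (mul_le_mul_of_nonneg_right hCC hh)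
  · calc b ≤ C * h := b2
      _ ≤ C * (C * t) := mul_le_mul_of_nonneg_left t1 hC0
      _ = _ := by ring
  · calc t ≤ C * h := t2
      _ ≤ C * (C * b) := mul_le_mul_of_nonneg_left b1 hC0
      _ = _ := by ring

end Equivalence
end RadTrans

end

open RadTrans
theorem mainTheorem7 (d : ℕ) (hd : 1 ≤ d) (α σmax M M' : ℝ) (hα : 0 < α) :
    ∃ C : ℝ≥0, ∀ (D : Set (Space d)) (σ : Space d × Dir d → ℝ) (K : Space d × Dir d × Dir d → ℝ),
      IsBoundedConvexDomain D → CrossSectionAssumption D σ σmax → KernelAssumption D K →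
      DominationAssumption D σ K α M M' →
      (∀ w : Space d × Dir d → ℝ, MemHZeroMinus D w →
        MemLp (radOp D σ K w) 2 (phaseMeasure D) ∧
        MemLp (transportOp D σ w) 2 (phaseMeasure D) ∧
        EquivWith C (hNorm D w) (l2Norm D (radOp D σ K w)) ∧
        EquivWith C (l2Norm D (radOp D σ K w)) (l2Norm D (transportOp D σ w))) ∧
      (∀ w : Space d × Dir d → ℝ, MemHZeroPlus D w →
        MemLp (radOpAdj D σ K w) 2 (phaseMeasure D) ∧
        MemLp (transportOpAdj D σ w) 2 (phaseMeasure D) ∧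
        EquivWith C (hNorm D w) (l2Norm D (radOpAdj D σ K w)) ∧
        EquivWith C (l2Norm D (radOpAdj D σ K w)) (l2Norm D (transportOpAdj D σ w))) := by
  refine ⟨(equivConst α σmax ^ 2).toNNReal, fun D σ K hD hσ hK hdom => ⟨fun w hw => ?_,
    fun w hw => ?_⟩⟩
  · exact equivWith_of_accretive hD hσ hK hdom.gap hdom.gap' hα hw.1 hw.1.memLp_transportDeriv rfl
      (MemHZeroMinus.inner_nonneg hD hw)
  · have he : hw.1.memLp_transportDeriv.neg.toLp (-transportDeriv D w) =
        -hw.1.memLp_transportDeriv.toLp _ := MemLp.toLp_neg _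
    -- Exchanging the directions of the kernel exchanges the two gap conditions.
    refine equivWith_of_accretive (K := swapKernel K) (g := -transportDeriv D w) hD hσ hK.swap
      hdom.gap' hdom.gap hα hw.1 hw.1.memLp_transportDeriv.neg ((congrArg norm he).trans (norm_neg _))
      ?_
    have h : 0 ≤ -inner ℝ (hw.1.1.toLp w) (hw.1.memLp_transportDeriv.toLp _) :=
      neg_nonneg.2 (MemHZeroPlus.inner_nonpos hD hw)
    rwa [← inner_neg_right, ← he] at h
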